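/- Let $k$ be a positive integer and let $\mathbb H_k=\{(z_1,z_2)\in\mathbb C^2 : |z_1|^k<|z_2|<1\}$. Let $\mathbb B_k$ be the Bergman kernel of $\mathbb H_k$, i.e. the unique function on $\mathbb H_k\times\mathbb H_k$ which is conjugate symmetric, satisfies $\mathbb B_k(\cdot,w)\in A^2(\mathbb H_k)$ for every $w\in\mathbb H_k$, and reproduces $f(z)=\int_{\mathbb H_k}\mathbb B_k(z,w)f(w)\,dV(w)$ for every $f\in A^2(\mathbb H_k)$ and $z\in\mathbb H_k$; here $dV$ is Lebesgue measure and $A^2(\mathbb H_k)$ is the space of square-integrable holomorphic functions on $\mathbb H_k$. Let $\delta_k(z)$ be the Euclidean distance from $z$ to the boundary of $\mathbb H_k$ in $\mathbb C^2$. Then $\mathbb B_k$ exists, and the following hold. 1. There are constants $c,C>0$, depending only on $k$, such that for all $z=(z_1,z_2)\in\mathbb H_k$ $$\frac{c}{(1-|z_2|)^2(|z_2|-|z_1|^k)^2}\le \mathbb B_k(z,z)\le \frac{C}{(1-|z_2|)^2(|z_2|-|z_1|^k)^2}.$$ 2. $\mathbb B_k(z,z)\approx\delta_k(z)^{-2}$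 as $z\to0$: there are constants $c',C'>0$ and a neighbourhood $U$ of the origin, depending only on $k$, such that $c'\,\delta_k(z)^{-2}\le\mathbb B_k(z,z)\le C'\,\delta_k(z)^{-2}$ for all $z\in\mathbb H_k\cap U$. -/

import Mathlib

open MeasureTheory Filter Topology
open scoped ComplexConjugate

namespace Hartogs

/-- The domain `ℍ_k = {(z₁, z₂) ∈ ℂ² : |z₁|^k < |z₂| < 1}`. -/
def hartogsTriangle (k : ℕ) : Set (ℂ × ℂ) :=
  {z | ‖z.1‖ ^ k < ‖z.2‖ ∧ ‖z.2‖ < 1}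

/-- Membership in the Bergman space `A²(Ω) = 𝒪(Ω) ∩ L²(Ω)`. The `volume` of `ℂ × ℂ` is the
product of two copies of planar Lebesgue measure, that is, Lebesgue measure on `ℂ²`. -/
structure MemBergman (Ω : Set (ℂ × ℂ)) (f : ℂ × ℂ → ℂ) : Prop where
  holomorphic : DifferentiableOn ℂ f Ω
  memLp : MemLp f 2 (volume.restrict Ω)

/-- `K` is a Bergman kernel of `Ω`: `K(·, w) ∈ A²(Ω)` for each `w ∈ Ω`, `K` is conjugate
symmetric, and `K` reproduces every function of `A²(Ω)`. -/
structure IsBergmanKernel (Ω : Set (ℂ × ℂ)) (K : ℂ × ℂ → ℂ × ℂ → ℂ) : Prop where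
  mem : ∀ w ∈ Ω, MemBergman Ω (fun z => K z w)
  symm : ∀ z ∈ Ω, ∀ w ∈ Ω, K z w = conj (K w z)
  reproducing : ∀ f, MemBergman Ω f → ∀ z ∈ Ω, f z = ∫ w in Ω, K z w * f w

/-- On the diagonal a Bergman kernel is real. -/
theorem IsBergmanKernel.diag_im {Ω : Set (ℂ × ℂ)} {K : ℂ × ℂ → ℂ × ℂ → ℂ}
    (hK : IsBergmanKernel Ω K) {z : ℂ × ℂ} (hz : z ∈ Ω) : (K z z).im = 0 :=
  Complex.conj_eq_iff_im.mp (hK.symm z hz z hz).symm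

/-- A Bergman kernel of an open set is unique on `Ω × Ω`. -/
theorem IsBergmanKernel.unique {Ω : Set (ℂ × ℂ)} (hΩ : IsOpen Ω)
    {K L : ℂ × ℂ → ℂ × ℂ → ℂ} (hK : IsBergmanKernel Ω K) (hL : IsBergmanKernel Ω L)
    {z w : ℂ × ℂ} (hz : z ∈ Ω) (hw : w ∈ Ω) : K z w = L z w := by
  have h1 : K z w = ∫ u in Ω, L z u * K u w := hL.reproducing _ (hK.mem w hw) z hz
  have h2 : L w z = ∫ u in Ω, K w u * L u z := hK.reproducing _ (hL.mem z hz) w hw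
  rw [hL.symm z hz w hw, h2, h1, ← integral_conj]
  refine setIntegral_congr_fun hΩ.measurableSet fun u hu => ?_
  simp only [map_mul]
  rw [← hK.symm u hu w hw, ← hL.symm z hz u hu, mul_comm]

open Classical in
/-- The Bergman kernel `𝔹_Ω` (with the value `0` if `Ω` had none). -/
noncomputable def bergmanKernel (Ω : Set (ℂ × ℂ)) : ℂ × ℂ → ℂ × ℂ → ℂ :=
  if h : ∃ K, IsBergmanKernel Ω K then h.choose else 0

theorem IsBergmanKernel.bergmanKernel_eq {Ω : Set (ℂ × ℂ)} (hΩ : IsOpen Ω)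
    {K : ℂ × ℂ → ℂ × ℂ → ℂ} (hK : IsBergmanKernel Ω K) {z w : ℂ × ℂ} (hz : z ∈ Ω) (hw : w ∈ Ω) :
    bergmanKernel Ω z w = K z w := by
  have h : ∃ K, IsBergmanKernel Ω K := ⟨K, hK⟩
  rw [bergmanKernel, dif_pos h]
  exact h.choose_spec.unique hΩ hK hz hw

/-- The Euclidean distance from `z` to the boundary of `Ω`. As `ℂ × ℂ` carries the maximum
norm, the distance is taken in `WithLp 2 (ℂ × ℂ)`, whose norm is the Euclidean one. -/
noncomputable def boundaryDist (Ω : Set (ℂ × ℂ)) (z : ℂ × ℂ) : ℝ :=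
  Metric.infDist (WithLp.toLp 2 z) (WithLp.toLp 2 '' frontier Ω)

/-- `A ≲ B` along a filter: `A ≤ K * B` eventually, for some constant `K > 0`. Along `𝓟 S` this
is the estimate on all of `S`, along `𝓝[S] a` it is the estimate as `z → a` within `S`. -/
def LesssimAlong (l : Filter (ℂ × ℂ)) (A B : ℂ × ℂ → ℝ) : Prop :=
  ∃ K : ℝ, 0 < K ∧ ∀ᶠ z in l, A z ≤ K * B z

/-- `A ≈ B` along a filter: `A ≲ B ≲ A`. -/
def ApproxAlong (l : Filter (ℂ × ℂ)) (A B : ℂ × ℂ → ℝ) : Prop :=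
  LesssimAlong l A B ∧ LesssimAlong l B A

end Hartogs

/-! The map (u, v) ↦ (uv, v^k) covers ℍ_k k times by 𝔻 × 𝔻*, with complex Jacobian k v^k. Hence f ↦
v^k · (f ∘ cover) carries A²(ℍ_k) into A²(𝔻 × 𝔻*). There the bidisc kernel reproduces
(`setIntegral_polydisc_bergman`), because a square integrable holomorphic function extends across a
puncture. The pullback is constant on orbits of the deck group (u, v) ↦ (ζ⁻ʲu, ζʲv), so the bidisc
kernel may be summed over an orbit, and the sum descends to ℍ_k.

The sum is explicit: sort (1 - y)⁻² = ∑ (n + 1) yⁿ by n mod k in both variables; orthogonality of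
roots of unity keeps only equal residues (`sum_bidisc_kernel`). This yields the rational function
`hartogsKernel`, which uniqueness identifies with `bergmanKernel`.

On the diagonal its numerator lies in [1, k³] (`diag_numerator_bounds`), and its denominator is the
model up to a bounded factor, by differences of squares (`diag_denominator_bounds`). Near the origin
1 - |z₂| ≥ 1/2, and |z₂| - |z₁|^k is comparable to δ: moving z₂ radially bounds δ above, a Lipschitz
estimate bounds it below. -/

namespace Hartogs

/-! ### Polar coordinates and the Bergman kernel of the disc -/

open Set in
theorem integral_eq_integral_polar {G : ℂ → ℂ} (hG : Integrable G) :
    ∫ z, G z = ∫ r in Ioi (0 : ℝ), ∫ θ in Ioo (-Real.pi) Real.pi,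
      (r : ℂ) * G (circleMap 0 r θ) := by
  have hsymm : ∀ p : ℝ × ℝ, Complex.polarCoord.symm p = circleMap 0 p.1 p.2 := fun p => by
    rw [Complex.polarCoord_symm_apply, circleMap, Complex.exp_mul_I]; simp
  have hint : IntegrableOn (fun p : ℝ × ℝ => (p.1 : ℂ) * G (circleMap 0 p.1 p.2))
      (Ioi (0 : ℝ) ×ˢ Ioo (-Real.pi) Real.pi) (volume.prod volume) := by
    have h1 : Integrable (fun q : ℝ × ℝ => G (Complex.measurableEquivRealProd.symm q)) :=
      (Complex.volume_preserving_equiv_real_prod.symm).integrable_comp_of_integrable hG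
    have h2 := (integrableOn_image_iff_integrableOn_abs_det_fderiv_smul volume
      (measurableSet_Ioi.prod measurableSet_Ioo)
      (fun p _ => (hasFDerivAt_polarCoord_symm p).hasFDerivWithinAt)
      polarCoord.symm.injOn _).1
      (h1.integrableOn (s := polarCoord.symm '' polarCoord.target))
    refine IntegrableOn.congr_fun h2 (fun p hp => ?_) (measurableSet_Ioi.prod measurableSet_Ioo)
    have hp1 : (0 : ℝ) < p.1 := hp.1
    simp only [det_fderivPolarCoordSymm, abs_of_pos hp1,
      Complex.measurableEquivRealProd_symm_polarCoord_symm_apply, hsymm, Complex.real_smul]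
  rw [← Complex.integral_comp_polarCoord_symm]
  simp only [hsymm, Complex.real_smul]
  exact setIntegral_prod _ hint

theorem setIntegral_ball_eq_polar {G : ℂ → ℂ} (hG : IntegrableOn G (Metric.ball 0 1)) :
    ∫ z in Metric.ball 0 1, G z = ∫ r in Set.Ioo (0 : ℝ) 1, ∫ θ in Set.Ioo (-Real.pi) Real.pi,
      (r : ℂ) * G (circleMap 0 r θ) := by
  rw [← integral_indicator measurableSet_ball,
    integral_eq_integral_polar (hG.integrable_indicator measurableSet_ball),
    ← Set.Ioi_inter_Iio (a := (0 : ℝ)), ← setIntegral_indicator measurableSet_Iio]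
  refine setIntegral_congr_fun measurableSet_Ioi fun r hr => ?_
  have hr : (0 : ℝ) < r := hr
  by_cases h : r < 1
  · rw [Set.indicator_of_mem (by exact h)]
    refine integral_congr_ae (Eventually.of_forall fun θ => ?_)
    simp [Set.indicator, abs_of_pos hr, h]
  · rw [Set.indicator_of_notMem (by exact h)]
    simp [Set.indicator, abs_of_pos hr, h]

/-- On |z| = r one has conj z = r² / z, so 1 - u₀ conj z = (z - r²u₀) / z. With dθ = dz / (iz) the
integral becomes Cauchy's formula for the derivative of u g(u) at r²u₀, a point inside the circle.
-/
theorem integral_circle_bergman {g : ℂ → ℂ} (hg : DifferentiableOn ℂ g (Metric.ball 0 1))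
    {u₀ : ℂ} (hu : ‖u₀‖ < 1) {r : ℝ} (hr : 0 < r) (hr1 : r < 1) :
    ∫ θ in Set.Ioo (-Real.pi) Real.pi,
      g (circleMap 0 r θ) / (1 - u₀ * conj (circleMap 0 r θ)) ^ 2 =
      2 * Real.pi * deriv (fun u => u * g u) (r ^ 2 * u₀) := by
  have hw : (r : ℂ) ^ 2 * u₀ ∈ Metric.ball (0 : ℂ) r := by
    simp only [mem_ball_zero_iff, norm_mul, norm_pow, Complex.norm_real, Real.norm_eq_abs,
      abs_of_pos hr]
    nlinarith [mul_pos hr hr, norm_nonneg u₀]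
  have key := Complex.two_pi_I_inv_smul_circleIntegral_sub_sq_inv_smul_of_differentiable
    Metric.isOpen_ball (Metric.closedBall_subset_ball hr1) (differentiableOn_id.mul hg) hw
  rw [circleIntegral] at key
  have hpt : ∀ θ : ℝ, deriv (circleMap 0 r) θ •
      ((circleMap 0 r θ - (r : ℂ) ^ 2 * u₀) ^ 2)⁻¹ • ((id : ℂ → ℂ) * g) (circleMap 0 r θ) =
      Complex.I * (g (circleMap 0 r θ) / (1 - u₀ * conj (circleMap 0 r θ)) ^ 2) := by
    intro θ
    have hz : circleMap 0 r θ ≠ 0 := circleMap_ne_center hr.ne'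
    have hn : circleMap 0 r θ * conj (circleMap 0 r θ) = (r : ℂ) ^ 2 := by
      rw [Complex.mul_conj, Complex.normSq_eq_norm_sq, norm_circleMap_zero, sq_abs]; simp
    have h1 : circleMap 0 r θ - (r : ℂ) ^ 2 * u₀ =
        circleMap 0 r θ * (1 - u₀ * conj (circleMap 0 r θ)) := by
      rw [← hn]; ring
    rw [deriv_circleMap, h1]
    simp only [smul_eq_mul, Pi.mul_apply, id]
    rw [mul_pow, mul_inv]
    field_simp
  simp only [hpt] at key
  rw [intervalIntegral.integral_const_mul] at key
  have hper : Function.Periodic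
      (fun θ : ℝ => g (circleMap 0 r θ) / (1 - u₀ * conj (circleMap 0 r θ)) ^ 2)
      (2 * Real.pi) := fun θ => by simp only [periodic_circleMap 0 r θ]
  have h2 := hper.intervalIntegral_add_eq (-Real.pi) 0
  rw [show -Real.pi + 2 * Real.pi = Real.pi by ring, zero_add,
    intervalIntegral.integral_of_le (by linarith [Real.pi_pos]),
    integral_Ioc_eq_integral_Ioo] at h2
  rw [h2]
  have h3 : deriv (fun u => u * g u) (r ^ 2 * u₀) = deriv ((id : ℂ → ℂ) * g) (r ^ 2 * u₀) := rfl
  rw [h3, ← key, smul_eq_mul]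
  have := Complex.I_ne_zero
  have : (Real.pi : ℂ) ≠ 0 := by exact_mod_cast Real.pi_ne_zero
  field_simp

theorem one_sub_mul_conj_norm_ge {a u : ℂ} (hu : ‖u‖ < 1) :
    1 - ‖a‖ ≤ ‖1 - a * conj u‖ := by
  have h := norm_sub_norm_le (1 : ℂ) (a * conj u)
  rw [norm_one, norm_mul, RCLike.norm_conj] at h
  nlinarith [norm_nonneg a]

/-- On the unit disc, `u ↦ (1 - a * conj u)⁻²` is bounded. -/
theorem norm_disc_kernel_le {a u : ℂ} (ha : ‖a‖ < 1) (hu : ‖u‖ < 1) :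
    ‖((1 - a * conj u) ^ 2)⁻¹‖ ≤ ((1 - ‖a‖) ^ 2)⁻¹ := by
  rw [norm_inv, norm_pow]
  have := one_sub_mul_conj_norm_ge (a := a) hu
  have : 0 < 1 - ‖a‖ := by linarith
  gcongr

theorem integrableOn_disc_kernel_mul {g : ℂ → ℂ} {s : Set ℂ} (hs : MeasurableSet s)
    (hsub : s ⊆ Metric.ball 0 1) (hi : IntegrableOn g s) {a : ℂ} (ha : ‖a‖ < 1) :
    IntegrableOn (fun u => g u / (1 - a * conj u) ^ 2) s := by
  simp only [div_eq_mul_inv]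
  refine Integrable.mul_bdd (c := ((1 - ‖a‖) ^ 2)⁻¹) hi ?_ ?_
  · have : Measurable fun u : ℂ => ((1 - a * conj u) ^ 2)⁻¹ :=
      (((measurable_const).sub ((Complex.continuous_conj.measurable).const_mul a)).pow_const 2).inv
    exact this.aestronglyMeasurable
  · filter_upwards [ae_restrict_mem hs] with u hu
    exact norm_disc_kernel_le ha (mem_ball_zero_iff.1 (hsub hu))

/-- The Bergman kernel of the unit disc reproduces integrable holomorphic functions. -/
theorem setIntegral_disc_bergman {g : ℂ → ℂ} (hg : DifferentiableOn ℂ g (Metric.ball 0 1))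
    (hi : IntegrableOn g (Metric.ball 0 1)) {u₀ : ℂ} (hu : ‖u₀‖ < 1) :
    ∫ u in Metric.ball 0 1, g u / (1 - u₀ * conj u) ^ 2 = Real.pi * g u₀ := by
  rw [setIntegral_ball_eq_polar
    (integrableOn_disc_kernel_mul measurableSet_ball subset_rfl hi hu)]
  have hmem : ∀ r ∈ Set.Icc (0 : ℝ) 1, (r : ℂ) ^ 2 * u₀ ∈ Metric.ball (0 : ℂ) 1 := by
    intro r hr
    simp only [mem_ball_zero_iff, norm_mul, norm_pow, Complex.norm_real, Real.norm_eq_abs,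
      abs_of_nonneg hr.1]
    nlinarith [hr.1, hr.2, norm_nonneg u₀, pow_le_one₀ (n := 2) hr.1 hr.2]
  have hh : DifferentiableOn ℂ (fun u => u * g u) (Metric.ball 0 1) := differentiableOn_id.mul hg
  have h1 : ∫ r in Set.Ioo (0 : ℝ) 1, ∫ θ in Set.Ioo (-Real.pi) Real.pi,
      (r : ℂ) * (g (circleMap 0 r θ) / (1 - u₀ * conj (circleMap 0 r θ)) ^ 2) =
      ∫ r in Set.Ioo (0 : ℝ) 1,
        (r : ℂ) * (2 * Real.pi * deriv (fun u => u * g u) (r ^ 2 * u₀)) := by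
    refine setIntegral_congr_fun measurableSet_Ioo fun r hr => ?_
    rw [integral_const_mul, integral_circle_bergman hg hu hr.1 hr.2]
  -- The radial integrand 2πr (u g)'(r²u₀) is the r-derivative of π r² g(r²u₀).
  rw [h1, ← integral_Ioc_eq_integral_Ioo, ← intervalIntegral.integral_of_le zero_le_one,
    intervalIntegral.integral_eq_sub_of_hasDerivAt
      (f := fun r : ℝ => Real.pi * ((r : ℂ) ^ 2 * g (r ^ 2 * u₀)))]
  · simp
  · intro r hr
    rw [Set.uIcc_of_le zero_le_one] at hr
    have hgd : HasDerivAt g (deriv g (r ^ 2 * u₀)) ((r : ℂ) ^ 2 * u₀) :=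
      (hg.differentiableAt (Metric.isOpen_ball.mem_nhds (hmem r hr))).hasDerivAt
    have hsq : HasDerivAt (fun z : ℂ => z ^ 2) (2 * (r : ℂ)) r := by
      simpa using hasDerivAt_pow 2 (r : ℂ)
    have hd : HasDerivAt (fun z : ℂ => Real.pi * (z ^ 2 * g (z ^ 2 * u₀)))
        (Real.pi * (2 * r * g (r ^ 2 * u₀) +
          r ^ 2 * (deriv g (r ^ 2 * u₀) * (2 * r * u₀)))) r :=
      (hsq.mul (HasDerivAt.comp (r : ℂ) hgd (hsq.mul_const u₀))).const_mul _
    have hm : deriv (fun u => u * g u) ((r : ℂ) ^ 2 * u₀) =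
        g (r ^ 2 * u₀) + (r ^ 2 * u₀) * deriv g (r ^ 2 * u₀) := by
      have := (hasDerivAt_id ((r : ℂ) ^ 2 * u₀)).mul hgd
      exact this.deriv.trans (by simp)
    refine hd.comp_ofReal.congr_deriv ?_
    rw [hm]; ring
  · refine ContinuousOn.intervalIntegrable ?_
    rw [Set.uIcc_of_le zero_le_one]
    have hc : ContinuousOn (deriv fun u => u * g u) (Metric.ball 0 1) :=
      (hh.deriv Metric.isOpen_ball).continuousOn
    have hc2 : ContinuousOn (fun r : ℝ => deriv (fun u => u * g u) ((r : ℂ) ^ 2 * u₀))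
        (Set.Icc 0 1) := hc.comp (by fun_prop) hmem
    fun_prop

/-! ### Square integrable functions on the punctured disc -/

theorem integral_ball_eq_scaled (h : ℂ → ℝ) (v : ℂ) {ρ : ℝ} (hρ : 0 < ρ) :
    ∫ u in Metric.ball 0 1, h (v + ρ * u) = (ρ ^ 2)⁻¹ * ∫ w in Metric.ball v ρ, h w := by
  have h1 := Measure.integral_comp_smul (volume : Measure ℂ)
    (fun w => (Metric.ball v ρ).indicator h (v + w)) ρ
  rw [integral_add_left_eq_self (fun w => (Metric.ball v ρ).indicator h w) v,
    Complex.finrank_real_complex, integral_indicator measurableSet_ball,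
    abs_of_pos (by positivity), smul_eq_mul] at h1
  rw [← h1, ← integral_indicator measurableSet_ball]
  refine integral_congr_ae (Eventually.of_forall fun u => ?_)
  simp [Set.indicator, abs_of_pos hρ, mul_lt_iff_lt_one_right hρ]

/-- Submean value property of `‖g‖ ^ 2` on a closed disc. -/
theorem sq_norm_le_integral_ball {g : ℂ → ℂ} {U : Set ℂ}
    (hg : DifferentiableOn ℂ g U) {v : ℂ} {ρ : ℝ} (hρ : 0 < ρ)
    (hsub : Metric.closedBall v ρ ⊆ U) :
    Real.pi * ρ ^ 2 * ‖g v‖ ^ 2 ≤ ∫ w in Metric.ball v ρ, ‖g w‖ ^ 2 := by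
  have hmaps : ∀ u ∈ Metric.closedBall (0 : ℂ) 1, v + ρ * u ∈ U := fun u hu => by
    refine hsub ?_
    rw [mem_closedBall_zero_iff] at hu
    rw [mem_closedBall_iff_norm, add_sub_cancel_left, norm_mul, Complex.norm_real,
      Real.norm_eq_abs, abs_of_pos hρ]
    nlinarith
  have hd : DifferentiableOn ℂ (fun u => g (v + ρ * u) ^ 2) (Metric.closedBall 0 1) :=
    (hg.comp (by fun_prop) hmaps).pow 2
  have hi : IntegrableOn (fun u => g (v + ρ * u) ^ 2) (Metric.ball 0 1) :=
    (hd.continuousOn.integrableOn_compact (isCompact_closedBall 0 1)).mono_set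
      Metric.ball_subset_closedBall
  -- At the centre the kernel is constant, so reproduction is the mean value property of g².
  have h1 := setIntegral_disc_bergman (hd.mono Metric.ball_subset_closedBall) hi
    (u₀ := 0) (by simp)
  have h2 : Real.pi * ‖g v‖ ^ 2 ≤ ∫ u in Metric.ball (0 : ℂ) 1, ‖g (v + ρ * u)‖ ^ 2 := by
    have h3 := norm_integral_le_integral_norm (μ := volume.restrict (Metric.ball (0 : ℂ) 1))
      fun u => g (v + ρ * u) ^ 2
    simp only [zero_mul, sub_zero, one_pow, div_one, mul_zero, add_zero] at h1
    rw [h1] at h3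
    simpa [abs_of_pos Real.pi_pos] using h3
  rw [integral_ball_eq_scaled (fun w => ‖g w‖ ^ 2) v hρ] at h2
  have h4 := mul_le_mul_of_nonneg_left h2 (sq_nonneg ρ)
  rw [mul_inv_cancel_left₀ (by positivity)] at h4
  linarith

/-- A square integrable holomorphic function on the punctured disc is `o(1 / v)` at the origin. -/
theorem isLittleO_of_memLp_punctured {g : ℂ → ℂ}
    (hg : DifferentiableOn ℂ g (Metric.ball 0 1 \ {0}))
    (h2 : MemLp g 2 (volume.restrict (Metric.ball 0 1 \ {0}))) :
    g =o[𝓝[≠] 0] fun v : ℂ => v⁻¹ := by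
  have hms : MeasurableSet (Metric.ball (0 : ℂ) 1 \ {0}) :=
    measurableSet_ball.diff (measurableSet_singleton 0)
  have hint : Integrable (fun v => ‖g v‖ ^ 2) (volume.restrict (Metric.ball 0 1 \ {0})) :=
    (memLp_two_iff_integrable_sq_norm h2.1).1 h2
  have hmeas : Tendsto (fun v : ℂ => (volume.restrict (Metric.ball (0 : ℂ) 1 \ {0}))
      (Metric.ball 0 (2 * ‖v‖))) (𝓝[≠] 0) (𝓝 0) := by
    have h0 : Tendsto (fun v : ℂ => volume (Metric.ball (0 : ℂ) (2 * ‖v‖))) (𝓝[≠] 0) (𝓝 0) := by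
      simp only [Complex.volume_ball]
      have : Continuous fun v : ℂ => ENNReal.ofReal (2 * ‖v‖) ^ 2 * (NNReal.pi : ENNReal) :=
        (ENNReal.continuous_mul_const ENNReal.coe_ne_top).comp
          ((ENNReal.continuous_pow 2).comp (ENNReal.continuous_ofReal.comp (by fun_prop)))
      simpa using (this.tendsto 0).mono_left nhdsWithin_le_nhds
    exact tendsto_of_tendsto_of_tendsto_of_le_of_le tendsto_const_nhds h0 (fun _ => zero_le)
      fun _ => Measure.restrict_apply_le _ _
  have hlim := hint.tendsto_setIntegral_nhds_zero hmeas
  rw [Asymptotics.isLittleO_iff]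
  intro c hc
  -- This threshold, against the submean inequality on the disc of radius |v|/2 about v, gives |v|
  -- |g v| < c.
  have hpos : 0 < Real.pi * (c / 2) ^ 2 := by positivity
  filter_upwards [hlim.eventually_lt_const hpos, self_mem_nhdsWithin,
    mem_nhdsWithin_of_mem_nhds (Metric.ball_mem_nhds (0 : ℂ) (by norm_num : (0 : ℝ) < 1 / 2))]
    with v hv hv0 hvb
  have hvn : 0 < ‖v‖ := norm_pos_iff.2 hv0
  rw [mem_ball_zero_iff] at hvb
  have hsub : Metric.closedBall v (‖v‖ / 2) ⊆ Metric.ball (0 : ℂ) 1 \ {0} := by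
    intro w hw
    rw [mem_closedBall_iff_norm] at hw
    refine ⟨?_, ?_⟩
    · rw [mem_ball_zero_iff]
      linarith [norm_sub_norm_le w v]
    · rintro rfl
      rw [zero_sub, norm_neg] at hw
      linarith
  have key := sq_norm_le_integral_ball hg (half_pos hvn) hsub
  have hle : ∫ w in Metric.ball v (‖v‖ / 2), ‖g w‖ ^ 2 ≤
      ∫ w in Metric.ball 0 (2 * ‖v‖), ‖g w‖ ^ 2 ∂(volume.restrict (Metric.ball 0 1 \ {0})) := by
    rw [Measure.restrict_restrict measurableSet_ball]
    refine setIntegral_mono_set (IntegrableOn.mono_set hint Set.inter_subset_right)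
      (Eventually.of_forall fun w => sq_nonneg _) (LE.le.eventuallyLE ?_)
    refine Set.subset_inter (fun w hw => ?_) (Metric.ball_subset_closedBall.trans hsub)
    rw [mem_ball_iff_norm] at hw
    rw [mem_ball_zero_iff]
    linarith [norm_sub_norm_le w v]
  have h5 : Real.pi * (‖v‖ / 2) ^ 2 * ‖g v‖ ^ 2 < Real.pi * (c / 2) ^ 2 :=
    (key.trans hle).trans_lt hv
  have h6 : (‖v‖ * ‖g v‖) ^ 2 < c ^ 2 := by
    nlinarith [Real.pi_pos]
  have h7 : ‖v‖ * ‖g v‖ < c := lt_of_pow_lt_pow_left₀ 2 hc.le h6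
  rw [norm_inv, ← div_eq_mul_inv, le_div_iff₀ hvn]
  linarith

/-- The Bergman kernel of the unit disc reproduces square integrable holomorphic functions on the
punctured disc. -/
theorem setIntegral_punctured_disc_bergman {g : ℂ → ℂ}
    (hg : DifferentiableOn ℂ g (Metric.ball 0 1 \ {0}))
    (h2 : MemLp g 2 (volume.restrict (Metric.ball 0 1 \ {0}))) {v₀ : ℂ}
    (hv : v₀ ∈ Metric.ball (0 : ℂ) 1 \ {0}) :
    ∫ v in Metric.ball 0 1 \ {0}, g v / (1 - v₀ * conj v) ^ 2 = Real.pi * g v₀ := by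
  set G := Function.update g 0 (limUnder (𝓝[≠] 0) g)
  have hinv : Tendsto (norm ∘ fun v : ℂ => v⁻¹) (𝓝[≠] 0) atTop :=
    tendsto_norm_inv_nhdsNE_zero_atTop
  have hGd : DifferentiableOn ℂ G (Metric.ball 0 1) := by
    refine Complex.differentiableOn_update_limUnder_of_isLittleO
      (Metric.ball_mem_nhds 0 one_pos) hg ?_
    simp only [sub_zero]
    -- The removable singularity criterion concerns g - g 0. The value g 0 is arbitrary but
    -- constant, hence o(1/v).
    exact (isLittleO_of_memLp_punctured hg h2).sub
      (Asymptotics.isLittleO_const_left.2 (Or.inr hinv))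
  have hms : MeasurableSet (Metric.ball (0 : ℂ) 1 \ {0}) :=
    measurableSet_ball.diff (measurableSet_singleton 0)
  have hGg : ∀ v ∈ Metric.ball (0 : ℂ) 1 \ {0}, G v = g v :=
    fun v hv => Function.update_of_ne hv.2 _ _
  have hset : (Metric.ball (0 : ℂ) 1 \ {0} : Set ℂ) =ᵐ[volume] Metric.ball (0 : ℂ) 1 :=
    sdiff_null_ae_eq_self (by simp)
  have : IsFiniteMeasure (volume.restrict (Metric.ball (0 : ℂ) 1 \ {0})) :=
    ⟨by rw [Measure.restrict_apply_univ]
        exact (measure_mono Set.sdiff_subset).trans_lt measure_ball_lt_top⟩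
  have hgi : IntegrableOn g (Metric.ball 0 1 \ {0}) := h2.integrable (by norm_num)
  have hGi : IntegrableOn G (Metric.ball 0 1) :=
    (hgi.congr_fun (fun v hv => (hGg v hv).symm) hms).congr_set_ae hset.symm
  have := setIntegral_disc_bergman hGd hGi (mem_ball_zero_iff.1 hv.1)
  rw [← hGg v₀ hv, ← this, ← setIntegral_congr_set hset]
  exact setIntegral_congr_fun hms fun v hv => by simp only [hGg v hv]

/-! ### Change of variables under the covering -/

open Set in
theorem lintegral_eq_lintegral_polar {h : ℂ → ENNReal} (hh : Measurable h) :
    ∫⁻ z, h z = ∫⁻ r in Ioi (0 : ℝ), ENNReal.ofReal r *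
      ∫⁻ θ in Ioo (-Real.pi) Real.pi, h (circleMap 0 r θ) := by
  have hsymm : ∀ p : ℝ × ℝ, Complex.polarCoord.symm p = circleMap 0 p.1 p.2 := fun p => by
    rw [Complex.polarCoord_symm_apply, circleMap, Complex.exp_mul_I]; simp
  have hcont : Continuous fun p : ℝ × ℝ => circleMap 0 p.1 p.2 := by
    unfold circleMap; fun_prop
  have hm : Measurable fun p : ℝ × ℝ => ENNReal.ofReal p.1 * h (circleMap 0 p.1 p.2) :=
    (measurable_fst.ennreal_ofReal).mul (hh.comp hcont.measurable)
  rw [← Complex.lintegral_comp_polarCoord_symm]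
  simp only [hsymm, smul_eq_mul]
  have h1 := setLIntegral_prod (μ := (volume : Measure ℝ)) (ν := (volume : Measure ℝ))
    (s := Ioi (0 : ℝ)) (t := Ioo (-Real.pi) Real.pi) _ hm.aemeasurable
  refine h1.trans (lintegral_congr fun r => ?_)
  have hc : Measurable fun θ => h (circleMap 0 r θ) :=
    hh.comp (continuous_circleMap 0 r).measurable
  change ∫⁻ θ in Ioo (-Real.pi) Real.pi, ENNReal.ofReal r * h (circleMap 0 r θ) = _
  rw [lintegral_const_mul _ hc]

/-- Multiplication by k on the circle group preserves Haar measure. This is read off from its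
ergodicity, which requires k > 1. -/
theorem lintegral_circleMap_mul {h : ℂ → ENNReal} (hh : Measurable h) {k : ℕ} (hk : 0 < k)
    (ρ : ℝ) :
    ∫⁻ θ in Set.Ioo (-Real.pi) Real.pi, h (circleMap 0 ρ (k * θ)) =
      ∫⁻ θ in Set.Ioo (-Real.pi) Real.pi, h (circleMap 0 ρ θ) := by
  rcases (Nat.succ_le_of_lt hk).eq_or_lt with rfl | hk1
  · simp
  have : Fact (0 < 2 * Real.pi) := ⟨Real.two_pi_pos⟩
  set f : AddCircle (2 * Real.pi) → ENNReal := fun b => h (ρ * (AddCircle.toCircle b : ℂ))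
  have hfm : Measurable f := hh.comp (by
    have : Continuous fun b : AddCircle (2 * Real.pi) => (ρ : ℂ) * (AddCircle.toCircle b : ℂ) := by
      have := AddCircle.continuous_toCircle (T := 2 * Real.pi)
      fun_prop
    exact this.measurable)
  have hf : ∀ θ : ℝ, f (θ : AddCircle (2 * Real.pi)) = h (circleMap 0 ρ θ) := fun θ => by
    simp only [f, AddCircle.toCircle_apply_mk, circleMap, Circle.coe_exp, zero_add]
    rw [div_self Real.two_pi_pos.ne', one_mul]
  have hset : ∀ F : AddCircle (2 * Real.pi) → ENNReal,
      ∫⁻ θ in Set.Ioo (-Real.pi) Real.pi, F (θ : AddCircle (2 * Real.pi)) = ∫⁻ b, F b := fun F => by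
    rw [← AddCircle.lintegral_preimage (2 * Real.pi) (-Real.pi) F,
      show -Real.pi + 2 * Real.pi = Real.pi by ring]
    exact setLIntegral_congr Ioo_ae_eq_Ioc
  have h1 : ∀ θ : ℝ, h (circleMap 0 ρ (k * θ)) = f (k • (θ : AddCircle (2 * Real.pi))) :=
    fun θ => by rw [← hf, ← AddCircle.coe_nsmul, nsmul_eq_mul]
  simp only [h1, ← hf]
  rw [hset f, hset fun b => f (k • b)]
  exact (AddCircle.ergodic_nsmul hk1).toMeasurePreserving.lintegral_comp hfm

theorem lintegral_pow_mul_comp_pow (B : ℝ → ENNReal) {k : ℕ} (hk : 0 < k) :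
    ∫⁻ r in Set.Ioi (0 : ℝ), ENNReal.ofReal (k * r ^ (k - 1)) * B (r ^ k) =
      ∫⁻ ρ in Set.Ioi (0 : ℝ), B ρ := by
  have himg : (fun r : ℝ => r ^ k) '' Set.Ioi 0 = Set.Ioi 0 := by
    ext ρ
    constructor
    · rintro ⟨r, hr, rfl⟩
      exact pow_pos (Set.mem_Ioi.1 hr) k
    · intro hρ
      exact ⟨ρ ^ (k : ℝ)⁻¹, Real.rpow_pos_of_pos hρ _,
        Real.rpow_inv_natCast_pow (le_of_lt hρ) hk.ne'⟩
  have := lintegral_image_eq_lintegral_deriv_mul_of_monotoneOn (s := Set.Ioi (0 : ℝ))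
    measurableSet_Ioi (f := fun r : ℝ => r ^ k) (f' := fun r => k * r ^ (k - 1))
    (fun r _ => (hasDerivAt_pow k r).hasDerivWithinAt)
    (fun a ha b _ hab => pow_le_pow_left₀ (le_of_lt ha) hab k) B
  rw [← this, himg]

/-- The change of variables `w = v ^ k` in the plane. -/
theorem lintegral_comp_complex_pow {h : ℂ → ENNReal} (hh : Measurable h) {k : ℕ} (hk : 0 < k) :
    ∫⁻ v, ENNReal.ofReal (k * ‖v‖ ^ (2 * (k - 1))) * h (v ^ k) = ∫⁻ w, h w := by
  have hm : Measurable fun v : ℂ => ENNReal.ofReal (k * ‖v‖ ^ (2 * (k - 1))) * h (v ^ k) :=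
    (Measurable.ennreal_ofReal (by fun_prop)).mul (hh.comp (by fun_prop))
  rw [lintegral_eq_lintegral_polar hm, lintegral_eq_lintegral_polar hh,
    ← lintegral_pow_mul_comp_pow (fun r => ENNReal.ofReal r *
      ∫⁻ θ in Set.Ioo (-Real.pi) Real.pi, h (circleMap 0 r θ)) hk]
  refine setLIntegral_congr_fun measurableSet_Ioi fun r hr => ?_
  have hr : (0 : ℝ) < r := hr
  have hpow : ∀ θ : ℝ, circleMap 0 r θ ^ k = circleMap 0 (r ^ k) (k * θ) := fun θ => by
    simp only [circleMap, zero_add, mul_pow, ← Complex.exp_nat_mul]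
    push_cast
    ring_nf
  simp only [norm_circleMap_zero, abs_of_pos hr, hpow]
  rw [lintegral_const_mul, lintegral_circleMap_mul hh hk, ← mul_assoc, ← mul_assoc,
    ← ENNReal.ofReal_mul hr.le, ← ENNReal.ofReal_mul (by positivity)]
  · congr 2
    obtain ⟨m, rfl⟩ := Nat.exists_eq_succ_of_ne_zero hk.ne'
    simp only [Nat.succ_eq_add_one, Nat.add_sub_cancel]
    ring
  · have : Continuous fun θ : ℝ => circleMap 0 (r ^ k) (k * θ) :=
      (continuous_circleMap 0 (r ^ k)).comp (by fun_prop)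
    exact hh.comp this.measurable

/-- The branched covering of the Hartogs triangle by a product of discs. -/
def cover (k : ℕ) (p : ℂ × ℂ) : ℂ × ℂ := (p.1 * p.2, p.2 ^ k)

theorem lintegral_comp_mul_const {h : ℂ → ENNReal} (hh : Measurable h) {v : ℂ} (hv : v ≠ 0) :
    ENNReal.ofReal (‖v‖ ^ 2) * ∫⁻ u, h (u * v) = ∫⁻ w, h w := by
  have hdet : LinearMap.det (LinearMap.mul ℝ ℂ v) = ‖v‖ ^ 2 := by
    rw [← Complex.normSq_eq_norm_sq]
    exact DFunLike.congr_fun Algebra.norm_complex_eq v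
  have hpos : 0 < ‖v‖ ^ 2 := by positivity
  have hmap := Measure.map_linearMap_addHaar_eq_smul_addHaar (volume : Measure ℂ)
    (f := LinearMap.mul ℝ ℂ v) (by rw [hdet]; exact hpos.ne')
  have hmeas : Measurable (LinearMap.mul ℝ ℂ v) := by
    have : (LinearMap.mul ℝ ℂ v : ℂ → ℂ) = fun u => v * u := rfl
    rw [this]; fun_prop
  have h1 : ∫⁻ u, h (u * v) = ∫⁻ w, h w ∂(Measure.map (LinearMap.mul ℝ ℂ v) volume) := by
    rw [lintegral_map hh hmeas]
    exact lintegral_congr fun u => by rw [mul_comm]; rfl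
  rw [h1, hmap, lintegral_smul_measure, smul_eq_mul, hdet, abs_of_pos (by positivity),
    ← mul_assoc, ← ENNReal.ofReal_mul hpos.le, mul_inv_cancel₀ hpos.ne', ENNReal.ofReal_one,
    one_mul]

/-- The `k`-fold change of variables `w = (u v, v ^ k)`. -/
theorem lintegral_comp_cover {h : ℂ × ℂ → ENNReal} (hh : Measurable h) {k : ℕ} (hk : 0 < k) :
    ∫⁻ p : ℂ × ℂ, ENNReal.ofReal (k * ‖p.2‖ ^ (2 * k)) * h (cover k p) = ∫⁻ w, h w := by
  have hm : Measurable fun p : ℂ × ℂ =>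
      ENNReal.ofReal (k * ‖p.2‖ ^ (2 * k)) * h (cover k p) :=
    (Measurable.ennreal_ofReal (by fun_prop)).mul (hh.comp (by unfold cover; fun_prop))
  rw [Measure.volume_eq_prod, lintegral_prod_symm _ hm.aemeasurable,
    lintegral_prod_symm _ hh.aemeasurable, 
    ← lintegral_comp_complex_pow (h := fun v => ∫⁻ u, h (u, v)) hh.lintegral_prod_left' hk]
  -- For v ≠ 0 the slice map u ↦ uv scales area by |v|², and k|v|^(2(k-1)) · |v|² = k|v|^(2k).
  have hae : ∀ᵐ v : ℂ, v ≠ 0 := by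
    rw [ae_iff]; simp
  refine lintegral_congr_ae ?_
  filter_upwards [hae] with v hv
  have hv1 : Measurable fun w => h (w, v ^ k) := hh.comp (by fun_prop)
  rw [← lintegral_comp_mul_const hv1 hv, ← mul_assoc,
    ← ENNReal.ofReal_mul (by positivity), ← lintegral_const_mul]
  · refine lintegral_congr fun u => ?_
    simp only [cover]
    congr 2
    obtain ⟨m, rfl⟩ := Nat.exists_eq_succ_of_ne_zero hk.ne'
    simp only [Nat.succ_eq_add_one, Nat.add_sub_cancel]
    ring
  · exact hv1.comp (by fun_prop)

/-- The product of the unit disc and the punctured unit disc. -/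
def polydisc : Set (ℂ × ℂ) := Metric.ball 0 1 ×ˢ (Metric.ball 0 1 \ {0})

theorem isOpen_polydisc : IsOpen polydisc :=
  Metric.isOpen_ball.prod (Metric.isOpen_ball.sdiff isClosed_singleton)

theorem mem_polydisc {p : ℂ × ℂ} : p ∈ polydisc ↔ ‖p.1‖ < 1 ∧ ‖p.2‖ < 1 ∧ p.2 ≠ 0 := by
  simp [polydisc]

theorem isOpen_hartogsTriangle (k : ℕ) : IsOpen (hartogsTriangle k) :=
  IsOpen.and (isOpen_lt ((continuous_fst.norm).pow k) continuous_snd.norm)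
    (isOpen_lt continuous_snd.norm continuous_const)

theorem snd_ne_zero_of_mem {k : ℕ} {z : ℂ × ℂ} (hz : z ∈ hartogsTriangle k) : z.2 ≠ 0 :=
  norm_pos_iff.1 ((by positivity : 0 ≤ ‖z.1‖ ^ k).trans_lt hz.1)

/-- For v ≠ 0, |uv|^k < |v|^k says |u| < 1. At v = 0 the strict inequality fails, whence the
puncture. -/
theorem cover_mem_iff {k : ℕ} (hk : 0 < k) {p : ℂ × ℂ} :
    cover k p ∈ hartogsTriangle k ↔ p ∈ polydisc := by
  rw [mem_polydisc]
  simp only [cover, hartogsTriangle, Set.mem_ofPred_eq, norm_mul, norm_pow, mul_pow]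
  rw [pow_lt_one_iff_of_nonneg (norm_nonneg _) hk.ne']
  constructor
  · rintro ⟨h1, h2⟩
    have h0 : p.2 ≠ 0 := by
      intro h
      simp [h, hk.ne'] at h1
    refine ⟨?_, h2, h0⟩
    have : 0 < ‖p.2‖ ^ k := by positivity
    rwa [mul_lt_iff_lt_one_left this, pow_lt_one_iff_of_nonneg (norm_nonneg _) hk.ne'] at h1
  · rintro ⟨h1, h2, h0⟩
    have : 0 < ‖p.2‖ ^ k := by positivity
    exact ⟨by rwa [mul_lt_iff_lt_one_left this, pow_lt_one_iff_of_nonneg (norm_nonneg _) hk.ne'], h2⟩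

theorem preimage_cover {k : ℕ} (hk : 0 < k) : cover k ⁻¹' hartogsTriangle k = polydisc :=
  Set.ext fun _ => cover_mem_iff hk

theorem exists_cover_eq {k : ℕ} (hk : 0 < k) {z : ℂ × ℂ} (hz : z ∈ hartogsTriangle k) :
    ∃ p ∈ polydisc, cover k p = z := by
  obtain ⟨v, hv⟩ := IsAlgClosed.exists_pow_nat_eq z.2 hk
  have hv0 : v ≠ 0 := by
    rintro rfl
    exact snd_ne_zero_of_mem hz (by rw [← hv, zero_pow hk.ne'])
  have h : cover k (z.1 / v, v) = z := by
    simp [cover, hv, div_mul_cancel₀ _ hv0]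
  exact ⟨_, (cover_mem_iff hk).1 (by rwa [h]), h⟩

theorem continuous_cover (k : ℕ) : Continuous (cover k) := by unfold cover; fun_prop

/-- The Jacobian density of `cover k`, divided by the number `k` of sheets. -/
noncomputable def coverDensity (k : ℕ) (p : ℂ × ℂ) : NNReal := k * ‖p.2‖₊ ^ (2 * k)

theorem measurable_coverDensity (k : ℕ) : Measurable (coverDensity k) := by
  unfold coverDensity; fun_prop

theorem coe_coverDensity (k : ℕ) (p : ℂ × ℂ) :
    (coverDensity k p : ENNReal) = ENNReal.ofReal (k * ‖p.2‖ ^ (2 * k)) := by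
  rw [← ENNReal.ofReal_coe_nnreal]
  simp [coverDensity]

/-- In this form `lintegral_comp_cover` transfers both Lebesgue and Bochner integrals, for
integrands that are only almost everywhere measurable. -/
theorem measurePreserving_cover {k : ℕ} (hk : 0 < k) :
    MeasurePreserving (cover k)
      ((volume : Measure (ℂ × ℂ)).withDensity fun p => coverDensity k p) volume := by
  refine ⟨(continuous_cover k).measurable, ?_⟩
  refine Measure.ext_of_lintegral _ fun h hh => ?_
  have hc : Measurable fun p => h (cover k p) := hh.comp (continuous_cover k).measurable
  rw [lintegral_map hh (continuous_cover k).measurable,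
    lintegral_withDensity_eq_lintegral_mul _ (measurable_coverDensity k).coe_nnreal_ennreal
      hc, ← lintegral_comp_cover hh hk]
  exact lintegral_congr fun p => by simp [coe_coverDensity]

theorem measurableSet_hartogsTriangle (k : ℕ) : MeasurableSet (hartogsTriangle k) :=
  (isOpen_hartogsTriangle k).measurableSet

theorem setLIntegral_hartogsTriangle {k : ℕ} (hk : 0 < k) {h : ℂ × ℂ → ENNReal}
    (hh : AEMeasurable h (volume.restrict (hartogsTriangle k))) :
    ∫⁻ w in hartogsTriangle k, h w = ∫⁻ p in polydisc, coverDensity k p * h (cover k p) := by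
  have hmp := (measurePreserving_cover hk).restrict_preimage (measurableSet_hartogsTriangle k)
  rw [preimage_cover hk] at hmp
  rw [← hmp.map_eq] at hh ⊢
  rw [lintegral_map' hh hmp.measurable.aemeasurable,
    restrict_withDensity isOpen_polydisc.measurableSet,
    lintegral_withDensity_eq_lintegral_mul_non_measurable _
      (measurable_coverDensity k).coe_nnreal_ennreal (by simp)]
  rfl

theorem setIntegral_hartogsTriangle {k : ℕ} (hk : 0 < k) {h : ℂ × ℂ → ℂ}
    (hh : AEStronglyMeasurable h (volume.restrict (hartogsTriangle k))) :
    ∫ w in hartogsTriangle k, h w =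
      ∫ p in polydisc, ((k * ‖p.2‖ ^ (2 * k) : ℝ) : ℂ) * h (cover k p) := by
  have hmp := (measurePreserving_cover hk).restrict_preimage (measurableSet_hartogsTriangle k)
  rw [preimage_cover hk] at hmp
  rw [← hmp.map_eq] at hh ⊢
  rw [integral_map hmp.measurable.aemeasurable hh,
    restrict_withDensity isOpen_polydisc.measurableSet,
    integral_withDensity_eq_integral_smul (measurable_coverDensity k)]
  refine integral_congr_ae (Eventually.of_forall fun p => ?_)
  simp [coverDensity, NNReal.smul_def]

/-! ### Pullback to the polydisc and reproduction there -/

/-- The pullback of a function on the Hartogs triangle, as a `2`-form, to the polydisc. -/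
def pullback (k : ℕ) (f : ℂ × ℂ → ℂ) (p : ℂ × ℂ) : ℂ := p.2 ^ k * f (cover k p)

theorem MemBergman.pullback_differentiableOn {k : ℕ} (hk : 0 < k) {f : ℂ × ℂ → ℂ}
    (hf : MemBergman (hartogsTriangle k) f) : DifferentiableOn ℂ (pullback k f) polydisc := by
  refine DifferentiableOn.mul (by fun_prop) (hf.holomorphic.comp ?_ fun p hp =>
    (cover_mem_iff hk).2 hp)
  unfold cover
  fun_prop

theorem MemBergman.pullback_memLp {k : ℕ} (hk : 0 < k) {f : ℂ × ℂ → ℂ}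
    (hf : MemBergman (hartogsTriangle k) f) :
    MemLp (pullback k f) 2 (volume.restrict polydisc) := by
  have hms := isOpen_polydisc.measurableSet
  refine ⟨(hf.pullback_differentiableOn hk).continuousOn.aestronglyMeasurable hms, ?_⟩
  have h1 := hf.memLp.2
  rw [eLpNorm_lt_top_iff_lintegral_rpow_enorm_lt_top (by norm_num) (by norm_num)] at h1 ⊢
  rw [setLIntegral_hartogsTriangle hk (hf.memLp.1.enorm.pow_const _)] at h1
  -- The density k|v|^(2k) dominates |v^k|² because k ≥ 1.
  refine lt_of_le_of_lt (lintegral_mono fun p => ?_) h1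
  simp only [pullback, coverDensity, enorm_mul, enorm_pow, ENNReal.toReal_ofNat,
    ENNReal.rpow_ofNat, mul_pow, ← pow_mul, ENNReal.coe_mul, ENNReal.coe_pow, ENNReal.coe_natCast]
  rw [mul_comm k 2]
  refine mul_le_mul_left ?_ _
  have : (1 : ENNReal) ≤ k := by exact_mod_cast hk
  calc _ = 1 * ‖p.2‖ₑ ^ (2 * k) := (one_mul _).symm
    _ ≤ k * ‖p.2‖ₑ ^ (2 * k) := mul_le_mul_left this _

/-- The Bergman kernel of the product of two discs reproduces square integrable holomorphic
functions on the product of a disc and a punctured disc. -/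
theorem setIntegral_polydisc_bergman {F : ℂ × ℂ → ℂ} (hF : DifferentiableOn ℂ F polydisc)
    (h2 : MemLp F 2 (volume.restrict polydisc)) {p : ℂ × ℂ} (hp : p ∈ polydisc) :
    IntegrableOn (fun q : ℂ × ℂ =>
      F q / ((1 - p.1 * conj q.1) ^ 2 * (1 - p.2 * conj q.2) ^ 2)) polydisc ∧
    ∫ q in polydisc, F q / ((1 - p.1 * conj q.1) ^ 2 * (1 - p.2 * conj q.2) ^ 2) =
      Real.pi ^ 2 * F p := by
  have hp' := mem_polydisc.1 hp
  have hmsD : MeasurableSet (Metric.ball (0 : ℂ) 1) := measurableSet_ball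
  have hmsP : MeasurableSet (Metric.ball (0 : ℂ) 1 \ {0}) :=
    measurableSet_ball.diff (measurableSet_singleton 0)
  have hms := isOpen_polydisc.measurableSet
  have : IsFiniteMeasure (volume.restrict polydisc) := by
    refine ⟨?_⟩
    rw [Measure.restrict_apply_univ]
    refine (measure_mono (Set.prod_mono_right Set.sdiff_subset)).trans_lt ?_
    rw [ball_prod_same]
    exact measure_ball_lt_top
  have hF1 : IntegrableOn F polydisc := h2.integrable (by norm_num)
  have hF2 : IntegrableOn (fun q => ‖F q‖ ^ 2) polydisc :=
    (memLp_two_iff_integrable_sq_norm h2.1).1 h2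
  have hmk : ∀ a : ℂ, Measurable fun u : ℂ => ((1 - a * conj u) ^ 2)⁻¹ := fun a =>
    ((measurable_const.sub (Complex.continuous_conj.measurable.const_mul a)).pow_const 2).inv
  have hG1 : IntegrableOn (fun q : ℂ × ℂ => F q / (1 - p.2 * conj q.2) ^ 2) polydisc := by
    simp only [div_eq_mul_inv]
    refine Integrable.mul_bdd (c := ((1 - ‖p.2‖) ^ 2)⁻¹) hF1
      ((hmk p.2).comp measurable_snd).aestronglyMeasurable ?_
    filter_upwards [ae_restrict_mem hms] with q hq
    exact norm_disc_kernel_le hp'.2.1 (mem_polydisc.1 hq).2.1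
  have hG2 : IntegrableOn (fun q : ℂ × ℂ =>
      F q / ((1 - p.1 * conj q.1) ^ 2 * (1 - p.2 * conj q.2) ^ 2)) polydisc := by
    have : ∀ q : ℂ × ℂ, F q / ((1 - p.1 * conj q.1) ^ 2 * (1 - p.2 * conj q.2) ^ 2) =
        F q / (1 - p.2 * conj q.2) ^ 2 * ((1 - p.1 * conj q.1) ^ 2)⁻¹ := fun q => by
      rw [div_eq_mul_inv, div_eq_mul_inv, mul_inv]; ring
    simp only [this]
    refine Integrable.mul_bdd (c := ((1 - ‖p.1‖) ^ 2)⁻¹) hG1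
      ((hmk p.1).comp measurable_fst).aestronglyMeasurable ?_
    filter_upwards [ae_restrict_mem hms] with q hq
    exact norm_disc_kernel_le hp'.1 (mem_polydisc.1 hq).1
  refine ⟨hG2, ?_⟩
  have hvol : (volume : Measure (ℂ × ℂ)).restrict polydisc =
      (volume.restrict (Metric.ball (0 : ℂ) 1)).prod
        (volume.restrict (Metric.ball (0 : ℂ) 1 \ {0})) := by
    rw [Measure.prod_restrict]; rfl
  have hslice : ∀ u ∈ Metric.ball (0 : ℂ) 1,
      DifferentiableOn ℂ (fun v => F (u, v)) (Metric.ball 0 1 \ {0}) := fun u hu =>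
    hF.comp (by fun_prop) fun v hv => ⟨hu, hv⟩
  -- By Fubini almost every slice in v is square integrable, so the punctured disc formula applies
  -- to it.
  have hsq : ∀ᵐ u ∂(volume.restrict (Metric.ball (0 : ℂ) 1)),
      ∫ v in Metric.ball 0 1 \ {0}, F (u, v) / (1 - p.2 * conj v) ^ 2 =
        Real.pi * F (u, p.2) := by
    have h3 := hF2
    rw [IntegrableOn, hvol] at h3
    filter_upwards [h3.prod_right_ae, ae_restrict_mem hmsD] with u hu hmem
    have hm := (hslice u hmem).continuousOn.aestronglyMeasurable (μ := volume) hmsP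
    exact setIntegral_punctured_disc_bergman (hslice u hmem)
      ((memLp_two_iff_integrable_sq_norm hm).2 hu) hp.2
  -- Square integrability on the single slice v = p.2 is not at hand. Integrability is, since by
  -- `hsq` the slice is 1/π times a partial integral of an integrable function; the disc formula
  -- needs no more.
  have hgi : IntegrableOn (fun u => F (u, p.2)) (Metric.ball 0 1) := by
    rw [IntegrableOn, hvol] at hG1
    refine (hG1.integral_prod_left.const_mul (Real.pi : ℂ)⁻¹).congr ?_
    filter_upwards [hsq] with u hu
    rw [hu, inv_mul_cancel_left₀ (by exact_mod_cast Real.pi_ne_zero)]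
  have hgd : DifferentiableOn ℂ (fun u => F (u, p.2)) (Metric.ball 0 1) :=
    hF.comp (by fun_prop) fun u hu => ⟨hu, hp.2⟩
  rw [IntegrableOn, hvol] at hG2
  rw [hvol, integral_prod _ hG2]
  have h4 : ∀ᵐ u ∂(volume.restrict (Metric.ball (0 : ℂ) 1)),
      ∫ v in Metric.ball 0 1 \ {0},
        F (u, v) / ((1 - p.1 * conj u) ^ 2 * (1 - p.2 * conj v) ^ 2) =
        Real.pi * (F (u, p.2) / (1 - p.1 * conj u) ^ 2) := by
    filter_upwards [hsq] with u hu
    have : ∀ v : ℂ, F (u, v) / ((1 - p.1 * conj u) ^ 2 * (1 - p.2 * conj v) ^ 2) =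
        ((1 - p.1 * conj u) ^ 2)⁻¹ * (F (u, v) / (1 - p.2 * conj v) ^ 2) := fun v => by
      rw [div_eq_mul_inv, div_eq_mul_inv, mul_inv]; ring
    simp only [this]
    rw [integral_const_mul, hu]
    ring
  rw [integral_congr_ae h4, integral_const_mul, setIntegral_disc_bergman hgd hgi hp'.1]
  ring

/-! ### Averaging over the deck group -/

/-- The numerator of `∑ᵢ (k i + c + 1) yⁱ = (c + 1 + (k - (c + 1)) y) / (1 - y) ^ 2`. -/
def classNumerator {R : Type*} [CommRing R] (k c : ℕ) (y : R) : R := (c + 1) + (k - (c + 1)) * y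

/-- The decomposition of ∑ (n + 1) yⁿ by residues n mod k, with denominators cleared so that it is a
polynomial identity. It follows from the closed forms of ∑ y^c and ∑ (c + 1) y^c. -/
theorem one_sub_sq_mul_sum_classNumerator {R : Type*} [CommRing R] (k : ℕ) (y : R) :
    (1 - y) ^ 2 * ∑ c ∈ Finset.range k, y ^ c * classNumerator k c (y ^ k) = (1 - y ^ k) ^ 2 := by
  have hS : (1 - y) * ∑ c ∈ Finset.range k, y ^ c = 1 - y ^ k := mul_neg_geom_sum y k
  have hT : ∀ n : ℕ, (1 - y) ^ 2 * ∑ c ∈ Finset.range n, ((c : R) + 1) * y ^ c =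
      1 - (n + 1) * y ^ n + n * y * y ^ n := by
    intro n
    induction n with
    | zero => simp
    | succ n ih =>
      rw [Finset.sum_range_succ, mul_add, ih]
      push_cast
      ring
  have hsplit : ∑ c ∈ Finset.range k, y ^ c * classNumerator k c (y ^ k) =
      (1 - y ^ k) * ∑ c ∈ Finset.range k, ((c : R) + 1) * y ^ c +
        k * y ^ k * ∑ c ∈ Finset.range k, y ^ c := by
    rw [Finset.mul_sum, Finset.mul_sum, ← Finset.sum_add_distrib]
    refine Finset.sum_congr rfl fun c _ => ?_
    rw [classNumerator]
    ring
  rw [hsplit]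
  linear_combination (1 - y ^ k) * hT k + k * y ^ k * (1 - y) * hS

/-- Orthogonality of characters: the sum is geometric with ratio ζ^(d-c), a k-th root of unity that
equals 1 only for c = d. -/
theorem sum_pow_roots_of_unity {k : ℕ} {ζ : ℂ} (hζ : IsPrimitiveRoot ζ k)
    {c d : ℕ} (hc : c < k) (hd : d < k) :
    ∑ j ∈ Finset.range k, ((ζ⁻¹) ^ j) ^ c * (ζ ^ j) ^ d = if c = d then (k : ℂ) else 0 := by
  have hk : 0 < k := by omega
  have hζ0 : ζ ≠ 0 := hζ.ne_zero hk.ne'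
  have hterm : ∀ j : ℕ, ((ζ⁻¹) ^ j) ^ c * (ζ ^ j) ^ d = ((ζ⁻¹) ^ c * ζ ^ d) ^ j := fun j => by
    rw [mul_pow, ← pow_mul, ← pow_mul, ← pow_mul, ← pow_mul, mul_comm j c, mul_comm j d]
  simp only [hterm]
  split_ifs with h
  · subst h
    simp [inv_mul_cancel₀ (pow_ne_zero c hζ0)]
  · have hne : (ζ⁻¹) ^ c * ζ ^ d ≠ 1 := fun h1 => by
      rw [inv_pow, inv_mul_eq_one₀ (pow_ne_zero _ hζ0)] at h1
      exact h (hζ.pow_inj hc hd h1)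
    have hpow : ((ζ⁻¹) ^ c * ζ ^ d) ^ k = 1 := by
      rw [mul_pow, ← pow_mul, ← pow_mul, mul_comm c, mul_comm d, pow_mul, pow_mul, inv_pow,
        hζ.pow_eq_one]
      simp
    have := geom_sum_mul ((ζ⁻¹) ^ c * ζ ^ d) k
    rw [hpow, sub_self] at this
    exact (mul_eq_zero.1 this).resolve_right (sub_ne_zero.2 hne)

/-- The average of the Bergman kernel of the bidisc over the deck group of `cover k`, up to a
constant factor. -/
noncomputable def averagedKernel (k : ℕ) (a b : ℂ) : ℂ :=
  (∑ c ∈ Finset.range k, (a * b) ^ c * (classNumerator k c (a ^ k) * classNumerator k c (b ^ k))) /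
    ((1 - a ^ k) ^ 2 * (1 - b ^ k) ^ 2)

theorem one_sub_ne_zero_of_norm_lt {a : ℂ} (ha : ‖a‖ < 1) : 1 - a ≠ 0 := by
  intro h
  rw [← sub_eq_zero.1 h, norm_one] at ha
  exact lt_irrefl _ ha

theorem inv_one_sub_sq_eq {k : ℕ} (hk : 0 < k) {a : ℂ} (ha : ‖a‖ < 1) :
    ((1 - a) ^ 2)⁻¹ =
      (∑ c ∈ Finset.range k, a ^ c * classNumerator k c (a ^ k)) / (1 - a ^ k) ^ 2 := by
  have h1 := one_sub_ne_zero_of_norm_lt ha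
  have h2 : 1 - a ^ k ≠ 0 := one_sub_ne_zero_of_norm_lt (by
    rw [norm_pow]; exact pow_lt_one₀ (norm_nonneg _) ha hk.ne')
  rw [← one_sub_sq_mul_sum_classNumerator k a] at *
  have h3 : ∑ c ∈ Finset.range k, a ^ c * classNumerator k c (a ^ k) ≠ 0 := by
    intro h
    have h4 := one_sub_sq_mul_sum_classNumerator k a
    rw [h, mul_zero] at h4
    exact h2 (pow_eq_zero_iff (two_ne_zero) |>.1 h4.symm)
  field_simp

/-- Rotation leaves a^k and b^k fixed, so expanding by residue classes c and d leaves j only in the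
factor ζ^(j(d-c)). Summation over j kills c ≠ d and gives k for c = d. -/
theorem sum_bidisc_kernel {k : ℕ} (hk : 0 < k) {ζ : ℂ} (hζ : IsPrimitiveRoot ζ k) {a b : ℂ}
    (ha : ‖a‖ < 1) (hb : ‖b‖ < 1) :
    ∑ j ∈ Finset.range k, ((1 - (ζ⁻¹) ^ j * a) ^ 2 * (1 - ζ ^ j * b) ^ 2)⁻¹ =
      k * averagedKernel k a b := by
  have hn : ‖ζ‖ = 1 := hζ.norm'_eq_one hk.ne'
  have hpa : ∀ j : ℕ, ((ζ⁻¹) ^ j * a) ^ k = a ^ k := fun j => by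
    rw [mul_pow, ← pow_mul, mul_comm j, pow_mul, inv_pow, hζ.pow_eq_one]; simp
  have hpb : ∀ j : ℕ, (ζ ^ j * b) ^ k = b ^ k := fun j => by
    rw [mul_pow, ← pow_mul, mul_comm j, pow_mul, hζ.pow_eq_one]; simp
  have hterm : ∀ j : ℕ, ((1 - (ζ⁻¹) ^ j * a) ^ 2 * (1 - ζ ^ j * b) ^ 2)⁻¹ =
      (∑ c ∈ Finset.range k, ∑ d ∈ Finset.range k, ((ζ⁻¹) ^ j) ^ c * (ζ ^ j) ^ d *
        (a ^ c * b ^ d * (classNumerator k c (a ^ k) * classNumerator k d (b ^ k)))) /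
        ((1 - a ^ k) ^ 2 * (1 - b ^ k) ^ 2) := fun j => by
    rw [mul_inv, inv_one_sub_sq_eq hk (a := (ζ⁻¹) ^ j * a) (by simpa [hn] using ha),
      inv_one_sub_sq_eq hk (a := ζ ^ j * b) (by simpa [hn] using hb), hpa, hpb, div_mul_div_comm,
      Finset.sum_mul_sum]
    congr 1
    refine Finset.sum_congr rfl fun c _ => Finset.sum_congr rfl fun d _ => ?_
    rw [mul_pow, mul_pow]
    ring
  simp only [hterm]
  rw [← Finset.sum_div, Finset.sum_comm, averagedKernel, ← mul_div_assoc, Finset.mul_sum]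
  congr 1
  refine Finset.sum_congr rfl fun c hc => ?_
  rw [Finset.sum_comm]
  have : ∀ d ∈ Finset.range k, ∑ j ∈ Finset.range k, ((ζ⁻¹) ^ j) ^ c * (ζ ^ j) ^ d *
      (a ^ c * b ^ d * (classNumerator k c (a ^ k) * classNumerator k d (b ^ k))) =
      if c = d then k * ((a * b) ^ c *
        (classNumerator k c (a ^ k) * classNumerator k c (b ^ k))) else 0 := fun d hd => by
    rw [← Finset.sum_mul,
      sum_pow_roots_of_unity hζ (Finset.mem_range.1 hc) (Finset.mem_range.1 hd)]
    split_ifs with h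
    · subst h; rw [mul_pow]
    · rw [zero_mul]
  rw [Finset.sum_congr rfl this, Finset.sum_ite_eq, if_pos hc]

/-- The Bergman kernel of the Hartogs triangle in closed form. -/
noncomputable def hartogsKernel (k : ℕ) (z w : ℂ × ℂ) : ℂ :=
  (∑ c ∈ Finset.range k, (z.1 * conj w.1) ^ c *
    (classNumerator k c ((z.1 * conj w.1) ^ k / (z.2 * conj w.2)) *
      classNumerator k c (z.2 * conj w.2))) /
  (k * Real.pi ^ 2 * (z.2 * conj w.2) *
    ((1 - (z.1 * conj w.1) ^ k / (z.2 * conj w.2)) ^ 2 * (1 - z.2 * conj w.2) ^ 2))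

theorem hartogsKernel_symm (k : ℕ) (z w : ℂ × ℂ) :
    hartogsKernel k z w = conj (hartogsKernel k w z) := by
  simp only [hartogsKernel, classNumerator, map_div₀, map_sum, map_mul, map_pow, map_sub, map_add,
    map_one, map_natCast, Complex.conj_conj, Complex.conj_ofReal, mul_comm]

/-- With a = p₁ conj q₁ and b = p₂ conj q₂, one has z₁ conj w₁ = ab and z₂ conj w₂ = b^k. The
averaged kernel involves only the invariants ab, a^k and b^k, so it descends. -/
theorem hartogsKernel_cover (k : ℕ) {p q : ℂ × ℂ} (hp : p.2 ≠ 0) (hq : q.2 ≠ 0) :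
    hartogsKernel k (cover k p) (cover k q) =
      averagedKernel k (p.1 * conj q.1) (p.2 * conj q.2) /
        (k * Real.pi ^ 2 * (p.2 * conj q.2) ^ k) := by
  have hb : p.2 * conj q.2 ≠ 0 := mul_ne_zero hp ((map_ne_zero _).2 hq)
  have h1 : p.1 * p.2 * conj (q.1 * q.2) = (p.1 * conj q.1) * (p.2 * conj q.2) := by
    rw [map_mul]; ring
  have h2 : p.2 ^ k * conj (q.2 ^ k) = (p.2 * conj q.2) ^ k := by
    rw [map_pow, mul_pow]
  simp only [hartogsKernel, cover, h1, h2, averagedKernel]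
  have h3 : ((p.1 * conj q.1) * (p.2 * conj q.2)) ^ k / (p.2 * conj q.2) ^ k =
      (p.1 * conj q.1) ^ k := by
    rw [mul_pow, mul_div_cancel_right₀ _ (pow_ne_zero _ hb)]
  rw [h3, div_div]
  congr 1
  ring

/-! ### Square integrability of the closed form -/

section bounds

variable {k : ℕ} {z w : ℂ × ℂ}

theorem norm_fst_lt_one (hz : z ∈ hartogsTriangle k) : ‖z.1‖ < 1 := by
  by_contra h
  exact absurd (hz.1.trans hz.2) (not_lt.2 (one_le_pow₀ (not_lt.1 h)))

theorem norm_fst_mul_conj_le (hz : z ∈ hartogsTriangle k) (hw : w ∈ hartogsTriangle k) :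
    ‖z.1 * conj w.1‖ ≤ 1 := by
  rw [norm_mul, RCLike.norm_conj]
  exact mul_le_one₀ (norm_fst_lt_one hz).le (norm_nonneg _) (norm_fst_lt_one hw).le

theorem norm_snd_mul_conj_le (hz : z ∈ hartogsTriangle k) :
    ‖z.2 * conj w.2‖ ≤ ‖w.2‖ := by
  rw [norm_mul, RCLike.norm_conj]
  exact mul_le_of_le_one_left (norm_nonneg _) hz.2.le

theorem norm_ratio_le (hz : z ∈ hartogsTriangle k) :
    ‖(z.1 * conj w.1) ^ k / (z.2 * conj w.2)‖ ≤ ‖w.1‖ ^ k / ‖w.2‖ := by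
  have h2 : 0 < ‖z.2‖ := norm_pos_iff.2 (snd_ne_zero_of_mem hz)
  rw [norm_div, norm_pow, norm_mul, norm_mul, RCLike.norm_conj, RCLike.norm_conj, mul_pow,
    mul_div_mul_comm]
  exact mul_le_of_le_one_left (by positivity) ((div_le_one h2).2 hz.1.le)

theorem ratio_lt_one (hw : w ∈ hartogsTriangle k) : ‖w.1‖ ^ k / ‖w.2‖ < 1 :=
  (div_lt_one (norm_pos_iff.2 (snd_ne_zero_of_mem hw))).2 hw.1

/-- For c < k both coefficients are nonnegative and they sum to k. -/
theorem norm_classNumerator_le {c : ℕ} (hc : c < k) {y : ℂ} (hy : ‖y‖ ≤ 1) :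
    ‖classNumerator k c y‖ ≤ k := by
  have h1 : ‖((c : ℂ) + 1)‖ = c + 1 := by
    exact_mod_cast Complex.norm_natCast (c + 1)
  have h2 : ‖((k : ℂ) - (c + 1))‖ = k - (c + 1) := by
    have := Complex.norm_natCast (k - (c + 1))
    rw [Nat.cast_sub hc, Nat.cast_sub hc] at this
    exact_mod_cast this
  have h3 : (0 : ℝ) ≤ k - (c + 1) := h2 ▸ norm_nonneg _
  calc ‖classNumerator k c y‖ ≤ ‖((c : ℂ) + 1)‖ + ‖((k : ℂ) - (c + 1)) * y‖ := norm_add_le _ _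
    _ ≤ (c + 1) + (k - (c + 1)) * 1 := by
      rw [norm_mul, h1, h2]; gcongr
    _ = k := by ring

theorem differentiableOn_fun_div {U : Set (ℂ × ℂ)} {f g : ℂ × ℂ → ℂ}
    (hf : DifferentiableOn ℂ f U) (hg : DifferentiableOn ℂ g U) (h0 : ∀ z ∈ U, g z ≠ 0) :
    DifferentiableOn ℂ (fun z => f z / g z) U := by
  simp only [div_eq_mul_inv]
  exact hf.mul (DifferentiableOn.inv hg h0)

theorem differentiableOn_hartogsKernel (hk : 0 < k) (hw : w ∈ hartogsTriangle k) :
    DifferentiableOn ℂ (fun z => hartogsKernel k z w) (hartogsTriangle k) := by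
  have ht : ∀ z ∈ hartogsTriangle k, z.2 * conj w.2 ≠ 0 := fun z hz =>
    mul_ne_zero (snd_ne_zero_of_mem hz) ((map_ne_zero _).2 (snd_ne_zero_of_mem hw))
  have hx : DifferentiableOn ℂ
      (fun z : ℂ × ℂ => (z.1 * conj w.1) ^ k / (z.2 * conj w.2)) (hartogsTriangle k) :=
    differentiableOn_fun_div (by fun_prop) (by fun_prop) ht
  unfold hartogsKernel classNumerator
  refine differentiableOn_fun_div ?_ ?_ fun z hz => ?_
  · refine DifferentiableOn.fun_sum fun c _ => ?_
    fun_prop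
  · fun_prop
  · refine mul_ne_zero (mul_ne_zero (mul_ne_zero ?_ ?_) (ht z hz)) (mul_ne_zero ?_ ?_)
    · exact_mod_cast hk.ne'
    · exact pow_ne_zero _ (by exact_mod_cast Real.pi_ne_zero)
    · exact pow_ne_zero _ (one_sub_ne_zero_of_norm_lt
        ((norm_ratio_le hz).trans_lt (ratio_lt_one hw)))
    · exact pow_ne_zero _ (one_sub_ne_zero_of_norm_lt ((norm_snd_mul_conj_le hz).trans_lt hw.2))

/-- For fixed w the only unbounded factor is 1/z₂. Since |z₂| = |v|^k upstairs, the pullback of the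
kernel is bounded on a set of finite volume, which gives membership in A². -/
theorem exists_norm_snd_mul_hartogsKernel_le (hk : 0 < k) (hw : w ∈ hartogsTriangle k) :
    ∃ C : ℝ, 0 ≤ C ∧ ∀ z ∈ hartogsTriangle k, ‖z.2‖ * ‖hartogsKernel k z w‖ ≤ C := by
  set e := 1 - ‖w.1‖ ^ k / ‖w.2‖
  set e' := 1 - ‖w.2‖
  have he : 0 < e := sub_pos.2 (ratio_lt_one hw)
  have he' : 0 < e' := sub_pos.2 hw.2
  have hw2 : 0 < ‖w.2‖ := norm_pos_iff.2 (snd_ne_zero_of_mem hw)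
  have hk' : (0 : ℝ) < k := by exact_mod_cast hk
  refine ⟨(k * (1 * (k * k))) / (k * Real.pi ^ 2 * ‖w.2‖ * (e ^ 2 * e' ^ 2)), by positivity,
    fun z hz => ?_⟩
  have hz2 : 0 < ‖z.2‖ := norm_pos_iff.2 (snd_ne_zero_of_mem hz)
  have hx := norm_ratio_le (w := w) hz
  have ht := norm_snd_mul_conj_le (w := w) hz
  have hnum : ‖∑ c ∈ Finset.range k, (z.1 * conj w.1) ^ c *
      (classNumerator k c ((z.1 * conj w.1) ^ k / (z.2 * conj w.2)) *
        classNumerator k c (z.2 * conj w.2))‖ ≤ k * (1 * (k * k)) := by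
    refine (norm_sum_le _ _).trans ?_
    have : ∀ c ∈ Finset.range k, ‖(z.1 * conj w.1) ^ c *
        (classNumerator k c ((z.1 * conj w.1) ^ k / (z.2 * conj w.2)) *
          classNumerator k c (z.2 * conj w.2))‖ ≤ 1 * (k * k) := fun c hc => by
      rw [norm_mul, norm_mul, norm_pow]
      gcongr
      · exact pow_le_one₀ (norm_nonneg _) (norm_fst_mul_conj_le hz hw)
      · exact norm_classNumerator_le (Finset.mem_range.1 hc) (hx.trans (ratio_lt_one hw).le)
      · exact norm_classNumerator_le (Finset.mem_range.1 hc) (ht.trans hw.2.le)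
    refine (Finset.sum_le_card_nsmul _ _ _ this).trans ?_
    simp
  have h1 : e ≤ ‖1 - (z.1 * conj w.1) ^ k / (z.2 * conj w.2)‖ := by
    have := norm_sub_norm_le (1 : ℂ) ((z.1 * conj w.1) ^ k / (z.2 * conj w.2))
    rw [norm_one] at this
    linarith
  have h2 : e' ≤ ‖1 - z.2 * conj w.2‖ := by
    have := norm_sub_norm_le (1 : ℂ) (z.2 * conj w.2)
    rw [norm_one] at this
    linarith
  rw [hartogsKernel, norm_div, mul_div_assoc', norm_mul, norm_mul, norm_mul, norm_mul z.2,
    RCLike.norm_conj, norm_mul, norm_pow (1 - _), norm_pow (1 - _), norm_pow, Complex.norm_natCast,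
    Complex.norm_real, Real.norm_eq_abs, abs_of_pos Real.pi_pos]
  have h3 : (k : ℝ) * Real.pi ^ 2 * (‖z.2‖ * ‖w.2‖) *
      (‖1 - (z.1 * conj w.1) ^ k / (z.2 * conj w.2)‖ ^ 2 * ‖1 - z.2 * conj w.2‖ ^ 2) =
      ‖z.2‖ * (k * Real.pi ^ 2 * ‖w.2‖ *
      (‖1 - (z.1 * conj w.1) ^ k / (z.2 * conj w.2)‖ ^ 2 * ‖1 - z.2 * conj w.2‖ ^ 2)) := by ring
  rw [h3, mul_div_mul_left _ _ hz2.ne']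
  gcongr

theorem memBergman_hartogsKernel (hk : 0 < k) (hw : w ∈ hartogsTriangle k) :
    MemBergman (hartogsTriangle k) fun z => hartogsKernel k z w := by
  have hd := differentiableOn_hartogsKernel hk hw
  have hm : AEStronglyMeasurable (fun z => hartogsKernel k z w)
      (volume.restrict (hartogsTriangle k)) :=
    hd.continuousOn.aestronglyMeasurable (measurableSet_hartogsTriangle k)
  refine ⟨hd, hm, ?_⟩
  obtain ⟨C, hC0, hC⟩ := exists_norm_snd_mul_hartogsKernel_le hk hw
  rw [eLpNorm_lt_top_iff_lintegral_rpow_enorm_lt_top (by norm_num) (by norm_num),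
    setLIntegral_hartogsTriangle hk (hm.enorm.pow_const _)]
  have hvol : volume polydisc < ⊤ := by
    refine (measure_mono (Set.prod_mono_right Set.sdiff_subset)).trans_lt ?_
    rw [ball_prod_same]
    exact measure_ball_lt_top
  refine (setLIntegral_mono' isOpen_polydisc.measurableSet
    (g := fun _ => (k : ENNReal) * ENNReal.ofReal C ^ 2) fun p hp => ?_).trans_lt ?_
  · have h1 := hC _ ((cover_mem_iff hk).2 hp)
    have h2 : ‖p.2‖ₑ ^ k * ‖hartogsKernel k (cover k p) w‖ₑ ≤ ENNReal.ofReal C := by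
      rw [← enorm_pow, ← enorm_mul, ← ofReal_norm, norm_mul]
      exact ENNReal.ofReal_le_ofReal h1
    calc _ = (k : ENNReal) * (‖p.2‖ₑ ^ k * ‖hartogsKernel k (cover k p) w‖ₑ) ^ 2 := by
          simp only [coverDensity, ENNReal.toReal_ofNat, ENNReal.rpow_ofNat, mul_pow, ← pow_mul,
            ENNReal.coe_mul, ENNReal.coe_pow, ENNReal.coe_natCast, mul_comm k 2, mul_assoc]
          rfl
      _ ≤ _ := by gcongr
  · rw [setLIntegral_const]
    exact ENNReal.mul_lt_top (ENNReal.mul_lt_top (ENNReal.natCast_lt_top k)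
      (ENNReal.pow_lt_top ENNReal.ofReal_lt_top)) hvol

end bounds

/-! ### The reproducing property -/

theorem hartogsKernel_reproducing {k : ℕ} (hk : 0 < k) {f : ℂ × ℂ → ℂ}
    (hf : MemBergman (hartogsTriangle k) f) {z : ℂ × ℂ} (hz : z ∈ hartogsTriangle k) :
    f z = ∫ w in hartogsTriangle k, hartogsKernel k z w * f w := by
  obtain ⟨p, hp, rfl⟩ := exists_cover_eq hk hz
  have hp' := mem_polydisc.1 hp
  have hζ := Complex.isPrimitiveRoot_exp k hk.ne'
  set ζ := Complex.exp (2 * Real.pi * Complex.I / k)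
  have hn : ‖ζ‖ = 1 := hζ.norm'_eq_one hk.ne'
  have hζ0 : ζ ≠ 0 := hζ.ne_zero hk.ne'
  have hms := isOpen_polydisc.measurableSet
  have hk0 : (k : ℂ) ≠ 0 := by exact_mod_cast hk.ne'
  have hpi : (Real.pi : ℂ) ≠ 0 := by exact_mod_cast Real.pi_ne_zero
  have hpj : ∀ j : ℕ, ((ζ⁻¹) ^ j * p.1, ζ ^ j * p.2) ∈ polydisc := fun j => by
    rw [mem_polydisc]
    simpa [hn, hζ0] using hp'
  -- Deck transformations fix both uv and v^k, so the pullback agrees at all orbit points.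
  have hpull : ∀ j : ℕ, pullback k f ((ζ⁻¹) ^ j * p.1, ζ ^ j * p.2) =
      p.2 ^ k * f (cover k p) := fun j => by
    have h1 : (ζ ^ j * p.2) ^ k = p.2 ^ k := by
      rw [mul_pow, ← pow_mul, mul_comm j, pow_mul, hζ.pow_eq_one, one_pow, one_mul]
    have h2 : (ζ⁻¹) ^ j * p.1 * (ζ ^ j * p.2) = p.1 * p.2 := by
      have h3 : (ζ⁻¹) ^ j * ζ ^ j = 1 := by rw [← mul_pow, inv_mul_cancel₀ hζ0, one_pow]
      linear_combination p.1 * p.2 * h3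
    simp only [pullback, cover, h1, h2]
  have hbi := fun j : ℕ => setIntegral_polydisc_bergman (hf.pullback_differentiableOn hk)
    (hf.pullback_memLp hk) (hpj j)
  -- Add the bidisc formulas at the k orbit points of p: the values coincide and the kernels sum to
  -- k times `averagedKernel`.
  have hsum : ∫ q in polydisc, pullback k f q * (k * averagedKernel k (p.1 * conj q.1)
      (p.2 * conj q.2)) = k * (Real.pi ^ 2 * (p.2 ^ k * f (cover k p))) := by
    have h1 : ∑ j ∈ Finset.range k, ∫ q in polydisc, pullback k f q /
        ((1 - (ζ⁻¹) ^ j * p.1 * conj q.1) ^ 2 * (1 - ζ ^ j * p.2 * conj q.2) ^ 2) =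
        k * (Real.pi ^ 2 * (p.2 ^ k * f (cover k p))) := by
      simp only [(hbi _).2, hpull, Finset.sum_const, Finset.card_range, nsmul_eq_mul]
    rw [← h1, ← integral_finsetSum _ fun j _ => (hbi j).1]
    refine setIntegral_congr_fun hms fun q hq => ?_
    have hq' := mem_polydisc.1 hq
    have hnorm : ∀ a b : ℂ, ‖a‖ < 1 → ‖b‖ < 1 → ‖a * conj b‖ < 1 := fun a b ha hb => by
      rw [norm_mul, RCLike.norm_conj]
      exact mul_lt_one_of_nonneg_of_lt_one_left (norm_nonneg _) ha hb.le
    simp only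
    rw [← sum_bidisc_kernel hk hζ (hnorm _ _ hp'.1 hq'.1) (hnorm _ _ hp'.2.1 hq'.2.1),
      Finset.mul_sum]
    exact Finset.sum_congr rfl fun j _ => by rw [div_eq_mul_inv, mul_assoc, mul_assoc]
  have hKm : AEStronglyMeasurable (fun w => hartogsKernel k (cover k p) w * f w)
      (volume.restrict (hartogsTriangle k)) := by
    refine AEStronglyMeasurable.mul ?_ hf.memLp.1
    have : hartogsKernel k (cover k p) =
        fun w => conj (hartogsKernel k w (cover k p)) := funext fun w => hartogsKernel_symm k _ w
    rw [this]
    exact Complex.continuous_conj.comp_aestronglyMeasurable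
      (memBergman_hartogsKernel hk hz).memLp.1
  rw [setIntegral_hartogsTriangle hk hKm]
  -- Split |q₂|^(2k) = q₂^k · conj q₂^k: the first factor completes the pullback, the second cancels
  -- against (p₂ conj q₂)^k in the kernel.
  have hpt : ∀ q ∈ polydisc, ((k * ‖q.2‖ ^ (2 * k) : ℝ) : ℂ) *
      (hartogsKernel k (cover k p) (cover k q) * f (cover k q)) =
      (k * (Real.pi ^ 2 * p.2 ^ k))⁻¹ * (pullback k f q * (k * averagedKernel k (p.1 * conj q.1)
      (p.2 * conj q.2))) := fun q hq => by
    have hq0 := (mem_polydisc.1 hq).2.2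
    have hq1 : conj q.2 ≠ 0 := (map_ne_zero _).2 hq0
    have hqn : ((‖q.2‖ : ℂ) ^ (2 * k)) = q.2 ^ k * conj q.2 ^ k := by
      rw [pow_mul, ← Complex.mul_conj', mul_pow]
    rw [hartogsKernel_cover k hp'.2.2 hq0, pullback]
    push_cast
    rw [hqn, mul_pow]
    have := hp'.2.2
    field_simp
  rw [setIntegral_congr_fun hms hpt, integral_const_mul, hsum]
  have := hp'.2.2
  field_simp

/-- The closed form is the Bergman kernel of the Hartogs triangle. -/
theorem isBergmanKernel_hartogsKernel {k : ℕ} (hk : 0 < k) :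
    IsBergmanKernel (hartogsTriangle k) (hartogsKernel k) where
  mem _ hw := memBergman_hartogsKernel hk hw
  symm z _ w _ := hartogsKernel_symm k z w
  reproducing _ hf _ hz := hartogsKernel_reproducing hk hf hz

/-! ### Two-sided bounds on the diagonal -/

variable {k : ℕ} {z w : ℂ × ℂ}

/-- The value is the convex combination (1 - y)(c + 1) + y k of numbers in [1, k]. -/
theorem classNumerator_bounds {c : ℕ} (hc : c < k) {y : ℝ} (h0 : 0 ≤ y) (h1 : y ≤ 1) :
    1 ≤ classNumerator k c y ∧ classNumerator k c y ≤ k := by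
  have h2 : ((c : ℝ) + 1) ≤ k := by exact_mod_cast hc
  have h3 : (0 : ℝ) ≤ c := Nat.cast_nonneg c
  rw [classNumerator]
  constructor <;> nlinarith [mul_nonneg (sub_nonneg.2 h2) h0,
    mul_nonneg (sub_nonneg.2 h2) (sub_nonneg.2 h1)]

theorem hartogsKernel_diag (k : ℕ) (z : ℂ × ℂ) :
    (hartogsKernel k z z).re =
      (∑ c ∈ Finset.range k, (‖z.1‖ ^ 2) ^ c *
        (classNumerator k c ((‖z.1‖ ^ 2) ^ k / ‖z.2‖ ^ 2) * classNumerator k c (‖z.2‖ ^ 2))) /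
      (k * Real.pi ^ 2 * ‖z.2‖ ^ 2 *
        ((1 - (‖z.1‖ ^ 2) ^ k / ‖z.2‖ ^ 2) ^ 2 * (1 - ‖z.2‖ ^ 2) ^ 2)) := by
  rw [← Complex.ofReal_re (_ / _)]
  congr 1
  simp only [hartogsKernel, classNumerator, Complex.mul_conj']
  push_cast
  rfl

/-- The term c = 0 alone is at least 1, even when z₁ = 0, and the others are nonnegative. Each of
the k terms is at most k². -/
theorem diag_numerator_bounds (hk : 0 < k) (hz : z ∈ hartogsTriangle k) :
    1 ≤ ∑ c ∈ Finset.range k, (‖z.1‖ ^ 2) ^ c *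
        (classNumerator k c ((‖z.1‖ ^ 2) ^ k / ‖z.2‖ ^ 2) * classNumerator k c (‖z.2‖ ^ 2)) ∧
    ∑ c ∈ Finset.range k, (‖z.1‖ ^ 2) ^ c *
        (classNumerator k c ((‖z.1‖ ^ 2) ^ k / ‖z.2‖ ^ 2) * classNumerator k c (‖z.2‖ ^ 2)) ≤
      (k : ℝ) ^ 3 := by
  have hs : ‖z.1‖ ^ 2 ≤ 1 := pow_le_one₀ (norm_nonneg _) (norm_fst_lt_one hz).le
  have ht : ‖z.2‖ ^ 2 ≤ 1 := pow_le_one₀ (norm_nonneg _) hz.2.le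
  have hx : (‖z.1‖ ^ 2) ^ k / ‖z.2‖ ^ 2 ≤ 1 := by
    refine div_le_one_of_le₀ ?_ (by positivity)
    rw [← pow_mul, mul_comm, pow_mul]
    exact pow_le_pow_left₀ (by positivity) hz.1.le 2
  have hA := fun c (hc : c < k) => classNumerator_bounds hc (by positivity) hx
  have hB := fun c (hc : c < k) => classNumerator_bounds hc (sq_nonneg ‖z.2‖) ht
  constructor
  · have h0 : 1 ≤ (‖z.1‖ ^ 2) ^ 0 * (classNumerator k 0 ((‖z.1‖ ^ 2) ^ k / ‖z.2‖ ^ 2) *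
        classNumerator k 0 (‖z.2‖ ^ 2)) := by
      rw [pow_zero, one_mul]
      exact one_le_mul_of_one_le_of_one_le (hA 0 hk).1 (hB 0 hk).1
    refine h0.trans (Finset.single_le_sum (f := fun c => (‖z.1‖ ^ 2) ^ c *
      (classNumerator k c ((‖z.1‖ ^ 2) ^ k / ‖z.2‖ ^ 2) * classNumerator k c (‖z.2‖ ^ 2)))
      (fun c hc => ?_) (Finset.mem_range.2 hk))
    have h1 := (hA c (Finset.mem_range.1 hc)).1
    have h2 := (hB c (Finset.mem_range.1 hc)).1
    positivity
  · refine (Finset.sum_le_card_nsmul _ _ (1 * ((k : ℝ) * k)) fun c hc => ?_).trans (le_of_eq ?_)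
    · have h1 := hA c (Finset.mem_range.1 hc)
      have h2 := hB c (Finset.mem_range.1 hc)
      have h3 : (0 : ℝ) ≤ classNumerator k c (‖z.2‖ ^ 2) := zero_le_one.trans h2.1
      have h4 : (0 : ℝ) ≤ classNumerator k c ((‖z.1‖ ^ 2) ^ k / ‖z.2‖ ^ 2) :=
        zero_le_one.trans h1.1
      exact mul_le_mul (pow_le_one₀ (by positivity) hs)
        (mul_le_mul h1.2 h2.2 h3 (by positivity)) (mul_nonneg h4 h3) zero_le_one
    · rw [Finset.card_range, nsmul_eq_mul]; ring

/-- The model quantity `(1 - |z₂|) ^ 2 (|z₂| - |z₁| ^ k) ^ 2`. -/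
noncomputable def modelDenominator (k : ℕ) (z : ℂ × ℂ) : ℝ :=
  (1 - ‖z.2‖) ^ 2 * (‖z.2‖ - ‖z.1‖ ^ k) ^ 2

theorem modelDenominator_pos (hz : z ∈ hartogsTriangle k) : 0 < modelDenominator k z := by
  have h1 := sub_pos.2 hz.1
  have h2 := sub_pos.2 hz.2
  rw [modelDenominator]
  positivity

/-- With x = |z₁|^k / |z₂|, differences of squares leave the model times (1 + x)²(1 + |z₂|)², a
factor in [1, 16]. -/
theorem diag_denominator_bounds (hz : z ∈ hartogsTriangle k) :
    modelDenominator k z ≤ ‖z.2‖ ^ 2 *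
        ((1 - (‖z.1‖ ^ 2) ^ k / ‖z.2‖ ^ 2) ^ 2 * (1 - ‖z.2‖ ^ 2) ^ 2) ∧
    ‖z.2‖ ^ 2 * ((1 - (‖z.1‖ ^ 2) ^ k / ‖z.2‖ ^ 2) ^ 2 * (1 - ‖z.2‖ ^ 2) ^ 2) ≤
      16 * modelDenominator k z := by
  have hr : 0 < ‖z.2‖ := norm_pos_iff.2 (snd_ne_zero_of_mem hz)
  have hr1 := hz.2
  have hm : 0 ≤ ‖z.1‖ ^ k := by positivity
  have hmr := hz.1
  have heq : ‖z.2‖ ^ 2 * ((1 - (‖z.1‖ ^ 2) ^ k / ‖z.2‖ ^ 2) ^ 2 * (1 - ‖z.2‖ ^ 2) ^ 2) =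
      modelDenominator k z * ((1 + ‖z.1‖ ^ k / ‖z.2‖) ^ 2 * (1 + ‖z.2‖) ^ 2) := by
    rw [modelDenominator, ← pow_mul, mul_comm 2 k, pow_mul]
    field_simp
    ring
  have hq0 : 0 ≤ ‖z.1‖ ^ k / ‖z.2‖ := by positivity
  have hq1 : ‖z.1‖ ^ k / ‖z.2‖ ≤ 1 := (div_le_one hr).2 hmr.le
  have h1 : 1 ≤ (1 + ‖z.1‖ ^ k / ‖z.2‖) ^ 2 := by nlinarith
  have h2 : (1 + ‖z.1‖ ^ k / ‖z.2‖) ^ 2 ≤ 4 := by nlinarith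
  have h3 : 1 ≤ (1 + ‖z.2‖) ^ 2 := by nlinarith
  have h4 : (1 + ‖z.2‖) ^ 2 ≤ 4 := by nlinarith
  have hE := (modelDenominator_pos hz).le
  rw [heq]
  constructor
  · exact le_mul_of_one_le_right hE (one_le_mul_of_one_le_of_one_le h1 h3)
  · rw [mul_comm 16]
    refine mul_le_mul_of_nonneg_left ?_ hE
    nlinarith

theorem hartogsKernel_diag_le (hk : 0 < k) (hz : z ∈ hartogsTriangle k) :
    (hartogsKernel k z z).re ≤ k ^ 2 * (1 / modelDenominator k z) := by
  have hE := modelDenominator_pos hz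
  have hk' : (0 : ℝ) < k := by exact_mod_cast hk
  have hpi : 1 ≤ Real.pi ^ 2 := by nlinarith [Real.pi_gt_three]
  rw [hartogsKernel_diag, mul_one_div]
  calc _ ≤ (k : ℝ) ^ 3 / (k * 1 * modelDenominator k z) := by
        refine div_le_div₀ (by positivity) (diag_numerator_bounds hk hz).2 (by positivity) ?_
        rw [mul_assoc (_ * _) (‖z.2‖ ^ 2)]
        gcongr
        exact (diag_denominator_bounds hz).1
    _ = _ := by field_simp

theorem inv_modelDenominator_le (hk : 0 < k) (hz : z ∈ hartogsTriangle k) :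
    1 / modelDenominator k z ≤ (16 * k * Real.pi ^ 2) * (hartogsKernel k z z).re := by
  have hE := modelDenominator_pos hz
  have hk' : (0 : ℝ) < k := by exact_mod_cast hk
  have hD := diag_denominator_bounds hz
  have hDpos := hE.trans_le hD.1
  rw [hartogsKernel_diag]
  calc 1 / modelDenominator k z =
      (16 * k * Real.pi ^ 2) * (1 / (k * Real.pi ^ 2 * (16 * modelDenominator k z))) := by
        have := Real.pi_ne_zero
        field_simp
    _ ≤ _ := by
        refine mul_le_mul_of_nonneg_left ?_ (by positivity)
        rw [mul_assoc (_ * _) (‖z.2‖ ^ 2)]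
        exact div_le_div₀ (zero_le_one.trans (diag_numerator_bounds hk hz).1)
          (diag_numerator_bounds hk hz).1 (by positivity)
          (mul_le_mul_of_nonneg_left hD.2 (by positivity))

/-! ### Distance to the boundary -/

/-- The points (w₁, τv) with ρ < τ < 1 lie in the domain and tend to w. Supplying v separately gives
a direction of approach even when w₂ = 0. -/
theorem frontier_hartogsTriangle_mem_of_eq (h1 : ‖w.1‖ ^ k = ‖w.2‖)
    (hw : ∃ v : ℂ, ‖w.2‖ < ‖v‖ ∧ ‖v‖ < 1 ∧ ∃ ρ : ℝ, 0 ≤ ρ ∧ w.2 = ρ * v) :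
    w ∈ frontier (hartogsTriangle k) := by
  obtain ⟨v, hv, hv1, ρ, hρ, hwv⟩ := hw
  have hv0 : 0 < ‖v‖ := (norm_nonneg _).trans_lt hv
  have hρ1 : ρ < 1 := by
    rw [hwv, norm_mul, Complex.norm_real, Real.norm_eq_abs, abs_of_nonneg hρ] at hv
    exact (mul_lt_iff_lt_one_left hv0).1 hv
  rw [(isOpen_hartogsTriangle k).frontier_eq]
  refine ⟨?_, fun h => absurd h.1 (by rw [h1]; exact lt_irrefl _)⟩
  have hcont : Continuous fun τ : ℝ => (w.1, (τ : ℂ) * v) := by fun_prop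
  have hmem : ρ ∈ closure (Set.Ioo ρ 1) := by
    rw [closure_Ioo hρ1.ne]; exact ⟨le_rfl, hρ1.le⟩
  have himg := image_closure_subset_closure_image hcont (Set.mem_image_of_mem _ hmem)
  have hweq : (w.1, (ρ : ℂ) * v) = w := by rw [← hwv]
  rw [hweq] at himg
  refine closure_mono ?_ himg
  rintro _ ⟨τ, hτ, rfl⟩
  have hτ0 : 0 ≤ τ := hρ.trans hτ.1.le
  refine ⟨?_, ?_⟩
  · simp only [norm_mul, Complex.norm_real, Real.norm_eq_abs, abs_of_nonneg hτ0]
    rw [h1, hwv, norm_mul, Complex.norm_real, Real.norm_eq_abs, abs_of_nonneg hρ]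
    exact mul_lt_mul_of_pos_right hτ.1 hv0
  · simp only [norm_mul, Complex.norm_real, Real.norm_eq_abs, abs_of_nonneg hτ0]
    nlinarith [hτ.2]

/-- Keep z₁ and shrink z₂ radially to modulus |z₁|^k. -/
theorem exists_frontier_point (hz : z ∈ hartogsTriangle k) :
    ∃ w ∈ frontier (hartogsTriangle k),
      dist (WithLp.toLp 2 z) (WithLp.toLp 2 w) = ‖z.2‖ - ‖z.1‖ ^ k := by
  have hr : 0 < ‖z.2‖ := norm_pos_iff.2 (snd_ne_zero_of_mem hz)
  set ρ : ℝ := ‖z.1‖ ^ k / ‖z.2‖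
  have hρ : 0 ≤ ρ := by positivity
  have hρ1 : ρ < 1 := ratio_lt_one hz
  have hn : ‖(ρ : ℂ) * z.2‖ = ‖z.1‖ ^ k := by
    rw [norm_mul, Complex.norm_real, Real.norm_eq_abs, abs_of_nonneg hρ]
    exact div_mul_cancel₀ _ hr.ne'
  refine ⟨(z.1, ρ * z.2), frontier_hartogsTriangle_mem_of_eq hn.symm
    ⟨z.2, by rw [hn]; exact hz.1, hz.2, ρ, hρ, rfl⟩, ?_⟩
  rw [WithLp.prod_dist_eq_of_L2]
  have h1 : dist z.2 (ρ * z.2) = ‖z.2‖ - ‖z.1‖ ^ k := by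
    have h2 : z.2 - ρ * z.2 = ((1 - ρ : ℝ) : ℂ) * z.2 := by push_cast; ring
    rw [dist_eq_norm, h2, norm_mul, Complex.norm_real, Real.norm_eq_abs,
      abs_of_pos (sub_pos.2 hρ1), sub_mul, one_mul, div_mul_cancel₀ _ hr.ne']
  change √(dist z.1 z.1 ^ 2 + dist z.2 (ρ * z.2) ^ 2) = _
  rw [dist_self, h1, zero_pow two_ne_zero, zero_add, Real.sqrt_sq (sub_pos.2 hz.1).le]

theorem boundaryDist_le (hz : z ∈ hartogsTriangle k) :
    boundaryDist (hartogsTriangle k) z ≤ ‖z.2‖ - ‖z.1‖ ^ k := by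
  obtain ⟨w, hw, hd⟩ := exists_frontier_point hz
  rw [← hd]
  exact Metric.infDist_le_dist_of_mem (Set.mem_image_of_mem _ hw)

/-- Where |z₁| ≤ 1, the function |z₂| - |z₁|^k is (k + 1)-Lipschitz, and it is nonpositive at
frontier points with |w₂| < 1. The other frontier points have |w₂| ≥ 1, hence distance at least 1/2
from z, which exceeds no less than |z₂| - |z₁|^k requires. -/
theorem le_boundaryDist (hz : z ∈ hartogsTriangle k) (hz2 : ‖z.2‖ ≤ 1 / 2) :
    (‖z.2‖ - ‖z.1‖ ^ k) / (k + 1) ≤ boundaryDist (hartogsTriangle k) z := by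
  have hne : (WithLp.toLp 2 '' frontier (hartogsTriangle k)).Nonempty := by
    obtain ⟨w, hw, -⟩ := exists_frontier_point hz
    exact ⟨_, Set.mem_image_of_mem _ hw⟩
  refine (Metric.le_infDist hne).2 ?_
  rintro _ ⟨w, hw, rfl⟩
  have hk0 : (0 : ℝ) ≤ k := Nat.cast_nonneg k
  have hm : 0 ≤ ‖z.1‖ ^ k := by positivity
  rw [(isOpen_hartogsTriangle k).frontier_eq] at hw
  have hcl : w.1 ∈ Metric.closedBall (0 : ℂ) 1 := by
    have hc : IsClosed {w : ℂ × ℂ | ‖w.1‖ ≤ 1} :=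
      isClosed_le continuous_fst.norm continuous_const
    have := closure_minimal (fun w (hw : w ∈ hartogsTriangle k) => (norm_fst_lt_one hw).le) hc hw.1
    exact mem_closedBall_zero_iff.2 this
  rw [mem_closedBall_zero_iff] at hcl
  set d := dist (WithLp.toLp 2 z) (WithLp.toLp 2 w)
  have hd : d = √(dist z.1 w.1 ^ 2 + dist z.2 w.2 ^ 2) := WithLp.prod_dist_eq_of_L2 _ _
  have hd1 : ‖w.1 - z.1‖ ≤ d := by
    rw [← dist_eq_norm, dist_comm, hd]
    exact Real.le_sqrt_of_sq_le (le_add_of_nonneg_right (sq_nonneg _))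
  have hd2 : ‖z.2 - w.2‖ ≤ d := by
    rw [← dist_eq_norm, hd]
    exact Real.le_sqrt_of_sq_le (le_add_of_nonneg_left (sq_nonneg _))
  rw [div_le_iff₀ (by positivity)]
  have hd0 : 0 ≤ d := dist_nonneg
  by_cases h : ‖w.2‖ < 1
  · have hw1 : ‖w.2‖ ≤ ‖w.1‖ ^ k := not_lt.1 fun h' => hw.2 ⟨h', h⟩
    have hpow := abs_pow_sub_pow_le ‖w.1‖ ‖z.1‖ k
    have hmax : max |‖w.1‖| |‖z.1‖| ^ (k - 1) ≤ 1 := by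
      rw [abs_norm, abs_norm]
      exact pow_le_one₀ (le_max_of_le_left (norm_nonneg _)) (max_le hcl (norm_fst_lt_one hz).le)
    have h1 : ‖w.1‖ ^ k - ‖z.1‖ ^ k ≤ d * k := by
      refine (le_abs_self _).trans (hpow.trans ?_)
      calc _ ≤ d * k * 1 := by
            gcongr
            exact (abs_norm_sub_norm_le _ _).trans hd1
        _ = d * k := mul_one _
    have h2 := (norm_sub_norm_le z.2 w.2).trans hd2
    linarith
  · have h2 := norm_sub_norm_le w.2 z.2
    rw [norm_sub_rev] at h2
    nlinarith

/-! ### The two estimates -/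

theorem isBergmanKernel_bergmanKernel (hk : 0 < k) :
    IsBergmanKernel (hartogsTriangle k) (bergmanKernel (hartogsTriangle k)) := by
  have hex : ∃ K, IsBergmanKernel (hartogsTriangle k) K := ⟨_, isBergmanKernel_hartogsKernel hk⟩
  rw [bergmanKernel, dif_pos hex]
  exact hex.choose_spec

theorem bergmanKernel_diag (hk : 0 < k) (hz : z ∈ hartogsTriangle k) :
    bergmanKernel (hartogsTriangle k) z z = hartogsKernel k z z :=
  (isBergmanKernel_hartogsKernel hk).bergmanKernel_eq (isOpen_hartogsTriangle k) hz hz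

theorem bergmanKernel_approx_model (hk : 0 < k) :
    ApproxAlong (𝓟 (hartogsTriangle k)) (fun z => (bergmanKernel (hartogsTriangle k) z z).re)
      (fun z => 1 / ((1 - ‖z.2‖) ^ 2 * (‖z.2‖ - ‖z.1‖ ^ k) ^ 2)) := by
  refine ⟨⟨k ^ 2, by positivity, eventually_principal.2 fun z hz => ?_⟩,
    ⟨16 * k * Real.pi ^ 2, by positivity, eventually_principal.2 fun z hz => ?_⟩⟩
  · beta_reduce
    rw [bergmanKernel_diag hk hz]
    exact hartogsKernel_diag_le hk hz
  · beta_reduce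
    rw [bergmanKernel_diag hk hz]
    exact inv_modelDenominator_le hk hz

theorem one_div_modelDenominator_le_boundaryDist (hz : z ∈ hartogsTriangle k)
    (hz2 : ‖z.2‖ ≤ 1 / 2) :
    1 / modelDenominator k z ≤ 4 * (1 / boundaryDist (hartogsTriangle k) z ^ 2) := by
  have hφ := sub_pos.2 hz.1
  have hδ : 0 < boundaryDist (hartogsTriangle k) z :=
    lt_of_lt_of_le (by positivity) (le_boundaryDist hz hz2)
  -- The factor 1/4 is the lower bound of (1 - |z₂|)² for |z₂| ≤ 1/2.
  have h2 : (1 / 4 : ℝ) * boundaryDist (hartogsTriangle k) z ^ 2 ≤ modelDenominator k z := by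
    rw [modelDenominator]
    have := boundaryDist_le hz
    gcongr
    nlinarith
  calc 1 / modelDenominator k z ≤ 1 / ((1 / 4 : ℝ) * boundaryDist (hartogsTriangle k) z ^ 2) :=
        one_div_le_one_div_of_le (by positivity) h2
    _ = _ := by field_simp

theorem one_div_boundaryDist_le_modelDenominator (hz : z ∈ hartogsTriangle k)
    (hz2 : ‖z.2‖ ≤ 1 / 2) :
    1 / boundaryDist (hartogsTriangle k) z ^ 2 ≤ (k + 1) ^ 2 * (1 / modelDenominator k z) := by
  have hφ := sub_pos.2 hz.1
  have hle := le_boundaryDist hz hz2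
  have hE := modelDenominator_pos hz
  have h3 : modelDenominator k z ≤ (‖z.2‖ - ‖z.1‖ ^ k) ^ 2 := by
    refine mul_le_of_le_one_left (sq_nonneg _) ?_
    have := norm_nonneg z.2
    nlinarith
  calc 1 / boundaryDist (hartogsTriangle k) z ^ 2
      ≤ 1 / ((‖z.2‖ - ‖z.1‖ ^ k) / (k + 1)) ^ 2 := by gcongr
    _ = (k + 1) ^ 2 * (1 / (‖z.2‖ - ‖z.1‖ ^ k) ^ 2) := by field_simp
    _ ≤ (k + 1) ^ 2 * (1 / modelDenominator k z) := by gcongr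

theorem bergmanKernel_approx_boundaryDist (hk : 0 < k) :
    ApproxAlong (𝓝[hartogsTriangle k] 0) (fun z => (bergmanKernel (hartogsTriangle k) z z).re)
      (fun z => boundaryDist (hartogsTriangle k) z ^ (-2 : ℤ)) := by
  have hnear : ∀ᶠ z : ℂ × ℂ in 𝓝[hartogsTriangle k] 0, z ∈ hartogsTriangle k ∧
      ‖z.2‖ ≤ 1 / 2 := by
    have h1 : ∀ᶠ z : ℂ × ℂ in 𝓝 0, ‖z.2‖ < 1 / 2 :=
      (continuous_snd.norm.tendsto' 0 0 (by simp)).eventually_lt_const (by norm_num)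
    filter_upwards [self_mem_nhdsWithin, mem_nhdsWithin_of_mem_nhds h1] with z hz h
    exact ⟨hz, le_of_lt h⟩
  refine ⟨⟨k ^ 2 * 4, by positivity, ?_⟩,
    ⟨(k + 1) ^ 2 * (16 * k * Real.pi ^ 2), by positivity, ?_⟩⟩
  · filter_upwards [hnear] with z ⟨hz, hz2⟩
    rw [bergmanKernel_diag hk hz, zpow_neg, zpow_ofNat, ← one_div, mul_assoc]
    refine (hartogsKernel_diag_le hk hz).trans ?_
    gcongr
    exact one_div_modelDenominator_le_boundaryDist hz hz2
  · filter_upwards [hnear] with z ⟨hz, hz2⟩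
    rw [bergmanKernel_diag hk hz, zpow_neg, zpow_ofNat, ← one_div, mul_assoc]
    refine (one_div_boundaryDist_le_modelDenominator hz hz2).trans ?_
    gcongr
    exact inv_modelDenominator_le hk hz

end Hartogs

theorem mainTheorem6 (k : ℕ) (hk : 0 < k) :
    Hartogs.IsBergmanKernel (Hartogs.hartogsTriangle k)
        (Hartogs.bergmanKernel (Hartogs.hartogsTriangle k)) ∧
      Hartogs.ApproxAlong (𝓟 (Hartogs.hartogsTriangle k))
        (fun z => (Hartogs.bergmanKernel (Hartogs.hartogsTriangle k) z z).re)
        (fun z => 1 / ((1 - ‖z.2‖) ^ 2 * (‖z.2‖ - ‖z.1‖ ^ k) ^ 2)) ∧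
      Hartogs.ApproxAlong (𝓝[Hartogs.hartogsTriangle k] (0 : ℂ × ℂ))
        (fun z => (Hartogs.bergmanKernel (Hartogs.hartogsTriangle k) z z).re)
        (fun z => Hartogs.boundaryDist (Hartogs.hartogsTriangle k) z ^ (-2 : ℤ)) :=
  ⟨Hartogs.isBergmanKernel_bergmanKernel hk, Hartogs.bergmanKernel_approx_model hk,
    Hartogs.bergmanKernel_approx_boundaryDist hk⟩
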